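/- Let $\mathbb{H}=\{z\in\mathbb{C}:\operatorname{Im} z>0\}$ and let $\mathbb{D}$ be the open unit disk. A bounded set $A\subset\mathbb{H}$ is called a hull if $\mathbb{H}\setminus A$ is a simply connected region. For a hull $A$ let $g_A\colon\mathbb{H}\setminus A\to\mathbb{H}$ be the unique conformal map of $\mathbb{H}\setminus A$ onto $\mathbb{H}$ with $g_A(z)=z+O(1/z)$ as $z\to\infty$, and let $\operatorname{hcap}(A)=\lim_{z\to\infty}z\,[g_A(z)-z]$ be its half-plane capacity. For a simply connected domain $D\subsetneq\mathbb{C}$ and $z\in D$ let $\operatorname{crad}(D,z)=|f'(0)|$ be the conformal radius of $D$ with respect to $z$, where $f$ is a conformal map of $\mathbb{D}$ onto $D$ with $f(0)=z$. There are absolute constants $C>0$ and $\varepsilon_0\in(0,1)$ such that for every $\varepsilon\le\varepsilon_0$ and every nonempty hull $A\subset\mathbb{H}$ with $\sup_{z\in A}|z|\le\varepsilon$, the half-plane capacity $\operatorname{hcap}(A)$ and the conformal radius $\operatorname{crad}(\mathbb{H}\setminus A,i)$ exist, $\operatorname{hcap}(A)>0$, and $$\left|\frac{2-\operatorname{crad}(\mathbb{H}\setminus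 A,i)}{\operatorname{hcap}(A)}-4\right|\le C\,\varepsilon .$$ -/

import Mathlib

open Filter Topology Asymptotics

noncomputable section

/-- `f` maps the open set `U` conformally (that is, bijectively and holomorphically) onto `V`. -/
def ConformalOnto (f : ℂ → ℂ) (U V : Set ℂ) : Prop :=
  DifferentiableOn ℂ f U ∧ Set.BijOn f U V

/-- A hull: a bounded subset `A` of the upper half-plane `ℍ` such that `ℍ \ A` is a simply connected
region (open, and simply connected in the topological sense, which includes being nonempty and
path connected). -/
structure IsHull (A : Set ℂ) : Prop where
  subset : A ⊆ UpperHalfPlane.upperHalfPlaneSet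
  bounded : Bornology.IsBounded A
  isOpen_compl : IsOpen (UpperHalfPlane.upperHalfPlaneSet \ A)
  simplyConnected_compl : IsSimplyConnected (UpperHalfPlane.upperHalfPlaneSet \ A)

/-- The filter `z → ∞` inside `ℍ \ A`. -/
def atInfty (A : Set ℂ) : Filter ℂ :=
  Bornology.cobounded ℂ ⊓ 𝓟 (UpperHalfPlane.upperHalfPlaneSet \ A)

/-- `g` maps `ℍ \ A` conformally onto `ℍ`, with the hydrodynamic normalization
`g z = z + O(1 / z)` as `z → ∞`. -/
def IsHydrodynamicMap (A : Set ℂ) (g : ℂ → ℂ) : Prop :=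
  ConformalOnto g (UpperHalfPlane.upperHalfPlaneSet \ A) UpperHalfPlane.upperHalfPlaneSet ∧
    (fun z => g z - z) =O[atInfty A] (fun z => z⁻¹)

/-- The number `h` is the limit of `z * (g z - z)` as `z → ∞`, for the hydrodynamically normalized
conformal map `g` of `ℍ \ A` onto `ℍ`. -/
def IsHalfPlaneCapacity (A : Set ℂ) (h : ℝ) : Prop :=
  ∃ g : ℂ → ℂ, IsHydrodynamicMap A g ∧
    Tendsto (fun z => z * (g z - z)) (atInfty A) (𝓝 (h : ℂ))

open Classical in
/-- The half-plane capacity of `A` (with the value `0` if `A` has none). -/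
def hcap (A : Set ℂ) : ℝ :=
  if H : ∃ h : ℝ, IsHalfPlaneCapacity A h then H.choose else 0

/-- The number `r` is `|f' 0|` for a conformal map `f` of the open unit disk onto `D` with
`f 0 = z`. -/
def IsConformalRadius (D : Set ℂ) (z : ℂ) (r : ℝ) : Prop :=
  ∃ f : ℂ → ℂ, ConformalOnto f (Metric.ball 0 1) D ∧ f 0 = z ∧ r = ‖deriv f 0‖

open Classical in
/-- The conformal radius of `D` with respect to `z` (with the value `0` if there is none). -/
def crad (D : Set ℂ) (z : ℂ) : ℝ :=
  if H : ∃ r : ℝ, IsConformalRadius D z r then H.choose else 0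

end

open Complex Set Metric
open ComplexConjugate
open UpperHalfPlane (upperHalfPlaneSet)

/-! ### Conformal maps and their inverses -/

/-! The hydrodynamic map is written as `g z = z - T (-1/z)` with `T` holomorphic near `0`, `T 0 = 0`
and `T' 0 = h`, so that `h` is the half-plane capacity. If `T` is close to `h ζ`, then `Im (g i) ≈ 1
- h` and `g' i = 1 + T' i ≈ 1 + h`, and the conformal radius `2 Im (g i) / |g' i|` is about `2 (1 -
h) / (1 + h) ≈ 2 - 4 h`. The point is that every error must be `O(ε h)`, hence small relative to `h`
and not only in absolute terms.

This comes from positivity. `Im T ≥ 0` on the upper half of a disk of radius `r = 1 / (2ε)` and `T`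
is symmetric, so `T` is typically real there. The function `(1 - ζ²/r²) T ζ / ζ` then has
nonnegative real part and value `h` at `0`, and Borel–Carathéodory gives `|T ζ - h ζ| ≤ 6 h |ζ|² /
r` (`norm_sub_le_of_typicallyReal`). The same bound, with `Im g > 0` at a point just above the hull,
gives `h = O(1/r²)`, which absorbs the quadratic terms.

To construct `g`, the domain is inverted by `z ↦ -1/z`, reflected, and glued across the real
interval `(-r, r)`. The Riemann map `Φ` of the resulting symmetric domain takes its upper part onto
a half-disk, and a Joukowski map opens that up to the half-plane (`IsHull.exists_conformalOnto`).
The Riemann mapping theorem is proved under the hypothesis that square roots exist, a property that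
passes easily to the glued domain. Uniqueness of `g` and of the conformal radius identifies the
chosen values `hcap` and `crad` with the computed ones. -/

lemma not_eventually_const_of_injOn {f : ℂ → ℂ} {U : Set ℂ} (hU : IsOpen U) (hi : InjOn f U)
    {z : ℂ} (hz : z ∈ U) : ¬ ∀ᶠ w in 𝓝 z, f w = f z := by
  intro h
  have h1 : ∀ᶠ w in 𝓝 z, w = z := by
    filter_upwards [h, hU.mem_nhds hz] with w hw hwU using hi hwU hz hw
  have h2 : ∀ᶠ w in 𝓝[≠] z, w = z := h1.filter_mono nhdsWithin_le_nhds
  obtain ⟨w, hw, hne⟩ := (h2.and self_mem_nhdsWithin).exists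
  exact hne hw

lemma map_nhds_of_injOn {f : ℂ → ℂ} {U : Set ℂ} (hU : IsOpen U) (hf : DifferentiableOn ℂ f U)
    (hi : InjOn f U) {z : ℂ} (hz : z ∈ U) : 𝓝 (f z) ≤ map f (𝓝 z) :=
  ((hf.analyticAt (hU.mem_nhds hz)).eventually_constant_or_nhds_le_map_nhds).resolve_left
    (not_eventually_const_of_injOn hU hi hz)

lemma isOpen_image_of_injOn {f : ℂ → ℂ} {U : Set ℂ} (hU : IsOpen U)
    (hf : DifferentiableOn ℂ f U) (hi : InjOn f U) : IsOpen (f '' U) := by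
  rw [isOpen_iff_mem_nhds]
  rintro _ ⟨z, hz, rfl⟩
  exact map_nhds_of_injOn hU hf hi hz (image_mem_map (hU.mem_nhds hz))

/-- The inverse of an injective holomorphic function is continuous. -/
lemma continuousAt_leftInvOn {f g : ℂ → ℂ} {U : Set ℂ} (hU : IsOpen U)
    (hf : DifferentiableOn ℂ f U) (hi : InjOn f U) (hg : LeftInvOn g f U) {z : ℂ} (hz : z ∈ U) :
    ContinuousAt g (f z) := by
  intro s hs
  rw [hg hz] at hs
  have h : ∀ᶠ v in map f (𝓝 z), g v ∈ s := by
    rw [eventually_map]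
    filter_upwards [hs, hU.mem_nhds hz] with w hw hwU
    rwa [hg hwU]
  exact map_nhds_of_injOn hU hf hi hz h

/-- Zeros of `f'` are isolated, since otherwise `f` would be locally constant. Away from them the
inverse function rule applies, and at them the continuous inverse has a removable singularity. -/
lemma differentiableAt_leftInvOn {f g : ℂ → ℂ} {U : Set ℂ} (hU : IsOpen U)
    (hf : DifferentiableOn ℂ f U) (hi : InjOn f U) (hg : LeftInvOn g f U) {z : ℂ} (hz : z ∈ U) :
    DifferentiableAt ℂ g (f z) := by
  have hcont : ∀ {w}, w ∈ U → ContinuousAt g (f w) := continuousAt_leftInvOn hU hf hi hg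
  have hV := isOpen_image_of_injOn hU hf hi
  have hreg : ∀ w ∈ U, deriv f w ≠ 0 → DifferentiableAt ℂ g (f w) := by
    intro w hw hd
    refine (HasDerivAt.of_local_left_inverse (hcont hw) (f := f) (f' := deriv f w) ?_ hd
      ?_).differentiableAt
    · rw [hg hw]
      exact (hf.differentiableAt (hU.mem_nhds hw)).hasDerivAt
    · filter_upwards [hV.mem_nhds (mem_image_of_mem f hw)]
      rintro _ ⟨v, hv, rfl⟩
      rw [hg hv]
  have hd : ∀ᶠ w in 𝓝[≠] z, deriv f w ≠ 0 := by
    have hA : AnalyticAt ℂ (deriv f) z := (hf.analyticAt (hU.mem_nhds hz)).deriv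
    refine hA.eventually_eq_zero_or_eventually_ne_zero.resolve_left fun h0 ↦ ?_
    obtain ⟨r, hr, hrU⟩ := Metric.eventually_nhds_iff_ball.1 (h0.and (hU.mem_nhds hz))
    refine not_eventually_const_of_injOn hU hi hz ?_
    filter_upwards [ball_mem_nhds z hr] with w hw
    exact isOpen_ball.is_const_of_deriv_eq_zero (convex_ball z r).isPreconnected
      (hf.mono fun v hv ↦ (hrU v hv).2) (fun v hv ↦ (hrU v hv).1) hw (mem_ball_self hr)
  refine (analyticAt_of_differentiable_on_punctured_nhds_of_continuousAt ?_
    (hcont hz)).differentiableAt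
  have h1 : ∀ᶠ w in 𝓝 z, w ≠ z → deriv f w ≠ 0 := eventually_nhdsWithin_iff.1 hd
  rw [eventually_nhdsWithin_iff]
  have h2 : ∀ᶠ v in map f (𝓝 z), v ∈ ({f z}ᶜ : Set ℂ) → DifferentiableAt ℂ g v := by
    rw [eventually_map]
    filter_upwards [h1, hU.mem_nhds hz] with w hw hwU hne
    exact hreg w hwU (hw fun h ↦ hne (by simp [h]))
  exact map_nhds_of_injOn hU hf hi hz h2

namespace ConformalOnto

variable {f g : ℂ → ℂ} {U V W : Set ℂ}

lemma comp (hg : ConformalOnto g V W) (hf : ConformalOnto f U V) :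
    ConformalOnto (g ∘ f) U W :=
  ⟨hg.1.comp hf.1 hf.2.mapsTo, hg.2.comp hf.2⟩

lemma symm (hU : IsOpen U) (hf : ConformalOnto f U V) :
    ∃ g, ConformalOnto g V U ∧ InvOn g f U V := by
  have hinv := hf.2.invOn_invFunOn
  refine ⟨_, ⟨fun w hw ↦ ?_, hf.2.symm hinv.symm⟩, hinv⟩
  obtain ⟨z, hz, rfl⟩ := hf.2.surjOn hw
  exact (differentiableAt_leftInvOn hU hf.1 hf.2.injOn hinv.1 hz).differentiableWithinAt

lemma isOpen (hU : IsOpen U) (hf : ConformalOnto f U V) : IsOpen V := by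
  rw [← hf.2.image_eq]
  exact isOpen_image_of_injOn hU hf.1 hf.2.injOn

lemma deriv_mul_deriv (hU : IsOpen U) (hf : ConformalOnto f U V) (hg : ConformalOnto g V U)
    (hinv : InvOn g f U V) {z : ℂ} (hz : z ∈ U) : deriv g (f z) * deriv f z = 1 := by
  have hf' := (hf.1.differentiableAt (hU.mem_nhds hz)).hasDerivAt
  have hg' := (hg.1.differentiableAt ((hf.isOpen hU).mem_nhds (hf.2.mapsTo hz))).hasDerivAt
  have h1 := (hg'.comp z hf').congr_of_eventuallyEq
    (f₁ := id) (by filter_upwards [hU.mem_nhds hz] with w hw using (hinv.1 hw).symm)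
  exact h1.unique (hasDerivAt_id z)

lemma deriv_ne_zero (hU : IsOpen U) (hf : ConformalOnto f U V) {z : ℂ} (hz : z ∈ U) :
    deriv f z ≠ 0 := by
  obtain ⟨g, hg, hinv⟩ := hf.symm hU
  exact right_ne_zero_of_mul_eq_one (hf.deriv_mul_deriv hU hg hinv hz)

end ConformalOnto

/-! ### Automorphisms of the disk -/

/-- A conformal automorphism of the unit disk fixing the origin is a rotation. -/
lemma ConformalOnto.rotation {ψ : ℂ → ℂ} (h : ConformalOnto ψ (ball 0 1) (ball 0 1))
    (h0 : ψ 0 = 0) : ‖deriv ψ 0‖ = 1 ∧ ∀ z ∈ ball (0 : ℂ) 1, ψ z = deriv ψ 0 * z := by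
  have hm : (0 : ℂ) ∈ ball (0 : ℂ) 1 := mem_ball_self one_pos
  have schwarz : ∀ {χ : ℂ → ℂ}, ConformalOnto χ (ball 0 1) (ball 0 1) → χ 0 = 0 →
      MapsTo χ (ball 0 1) (closedBall (χ 0) 1) := by
    intro χ hχ hχ0 z hz
    rw [hχ0]
    exact ball_subset_closedBall (hχ.2.mapsTo hz)
  obtain ⟨g, hg, hinv⟩ := h.symm isOpen_ball
  have hg0 : g 0 = 0 := by simpa [h0] using hinv.1 hm
  have e := h.deriv_mul_deriv isOpen_ball hg hinv hm
  -- Schwarz bounds the derivatives of `ψ` and of its inverse by one. Their product is one, so the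
  -- equality case holds.
  have b1 := norm_deriv_le_one_of_mapsTo_ball h.1 (schwarz h h0) one_pos
  have b2 := norm_deriv_le_one_of_mapsTo_ball hg.1 (schwarz hg hg0) one_pos
  have e' : ‖deriv g 0‖ * ‖deriv ψ 0‖ = 1 := by simpa [h0] using congrArg norm e
  have hn : ‖deriv ψ 0‖ = 1 := by nlinarith [norm_nonneg (deriv g 0), norm_nonneg (deriv ψ 0)]
  refine ⟨hn, fun z hz ↦ ?_⟩
  have := affine_of_mapsTo_ball_of_norm_dslope_eq_div h.1 (schwarz h h0) hm
    (by simpa using hn) hz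
  simpa [h0, mul_comm] using this

/-- The disk automorphism `w ↦ (w - a) / (1 - conj a * w)`. -/
noncomputable def diskMoebius (a w : ℂ) : ℂ := (w - a) / (1 - (starRingEnd ℂ) a * w)

lemma diskMoebius_den_ne_zero {a w : ℂ} (ha : ‖a‖ < 1) (hw : ‖w‖ < 1) :
    1 - (starRingEnd ℂ) a * w ≠ 0 := by
  intro h
  have : ‖(starRingEnd ℂ) a * w‖ = 1 := by rw [← sub_eq_zero.1 h, norm_one]
  rw [norm_mul, RCLike.norm_conj] at this
  nlinarith [norm_nonneg a, norm_nonneg w]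

lemma norm_diskMoebius_lt_one {a w : ℂ} (ha : ‖a‖ < 1) (hw : ‖w‖ < 1) :
    ‖diskMoebius a w‖ < 1 := by
  have hd := diskMoebius_den_ne_zero ha hw
  rw [diskMoebius, norm_div, div_lt_one (norm_pos_iff.2 hd)]
  refine lt_of_pow_lt_pow_left₀ 2 (norm_nonneg _) ?_
  have ha' : normSq a < 1 := by rw [normSq_eq_norm_sq]; nlinarith [norm_nonneg a]
  have hw' : normSq w < 1 := by rw [normSq_eq_norm_sq]; nlinarith [norm_nonneg w]
  rw [← normSq_eq_norm_sq, ← normSq_eq_norm_sq]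
  simp only [normSq_apply, sub_re, sub_im, mul_re, mul_im, one_re, one_im, conj_re, conj_im] at *
  nlinarith

lemma diskMoebius_neg_diskMoebius {a w : ℂ} (ha : ‖a‖ < 1) (hw : ‖w‖ < 1) :
    diskMoebius (-a) (diskMoebius a w) = w := by
  have hd := diskMoebius_den_ne_zero ha hw
  have ha' := diskMoebius_den_ne_zero ha ha
  have h2 : 1 + (starRingEnd ℂ) a * ((w - a) / (1 - (starRingEnd ℂ) a * w)) ≠ 0 := by
    have : 1 + (starRingEnd ℂ) a * ((w - a) / (1 - (starRingEnd ℂ) a * w)) =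
        (1 - (starRingEnd ℂ) a * a) / (1 - (starRingEnd ℂ) a * w) := by
      field_simp; ring
    rw [this]
    exact div_ne_zero ha' hd
  simp only [diskMoebius, map_neg, neg_mul, sub_neg_eq_add]
  rw [div_eq_iff h2]
  linear_combination div_mul_cancel₀ (w - a) hd

@[simp] lemma diskMoebius_self (a : ℂ) : diskMoebius a a = 0 := by simp [diskMoebius]

lemma conformalOnto_diskMoebius {a : ℂ} (ha : ‖a‖ < 1) :
    ConformalOnto (diskMoebius a) (ball 0 1) (ball 0 1) := by
  have hn : ‖-a‖ < 1 := by simpa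
  refine ⟨fun w hw ↦ ?_, ?_⟩
  · have := diskMoebius_den_ne_zero ha (mem_ball_zero_iff.1 hw)
    unfold diskMoebius
    exact DifferentiableAt.differentiableWithinAt (by fun_prop (disch := assumption))
  · refine InvOn.bijOn (f' := diskMoebius (-a)) ⟨fun w hw ↦ ?_, fun w hw ↦ ?_⟩
      (fun w hw ↦ ?_) (fun w hw ↦ ?_)
    · exact diskMoebius_neg_diskMoebius ha (mem_ball_zero_iff.1 hw)
    · simpa using diskMoebius_neg_diskMoebius hn (mem_ball_zero_iff.1 hw)
    · exact mem_ball_zero_iff.2 (norm_diskMoebius_lt_one ha (mem_ball_zero_iff.1 hw))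
    · exact mem_ball_zero_iff.2 (norm_diskMoebius_lt_one hn (mem_ball_zero_iff.1 hw))

/-! ### The Cayley transform -/

/-- The Cayley transform of the upper half-plane sending `q` to the origin. -/
noncomputable def cayley (q w : ℂ) : ℂ := (w - q) / (w - (starRingEnd ℂ) q)

lemma cayley_den_ne_zero {q w : ℂ} (hq : 0 < q.im) (hw : 0 < w.im) :
    w - (starRingEnd ℂ) q ≠ 0 := by
  intro h
  have := congrArg Complex.im h
  simp at this
  linarith

@[simp] lemma cayley_self (q : ℂ) : cayley q q = 0 := by simp [cayley]

lemma conformalOnto_cayley {q : ℂ} (hq : 0 < q.im) :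
    ConformalOnto (cayley q) UpperHalfPlane.upperHalfPlaneSet (ball 0 1) := by
  refine ⟨fun w hw ↦ ?_, ?_, ?_, ?_⟩
  · have := cayley_den_ne_zero hq hw
    unfold cayley
    exact DifferentiableAt.differentiableWithinAt (by fun_prop (disch := assumption))
  · intro w hw
    have hd := cayley_den_ne_zero hq hw
    rw [mem_ball_zero_iff, cayley, norm_div, div_lt_one (norm_pos_iff.2 hd)]
    refine lt_of_pow_lt_pow_left₀ 2 (norm_nonneg _) ?_
    rw [← normSq_eq_norm_sq, ← normSq_eq_norm_sq]
    have hw' : 0 < w.im := hw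
    simp only [normSq_apply, sub_re, sub_im, conj_re, conj_im]
    nlinarith
  · intro w hw v hv h
    rw [cayley, cayley, div_eq_div_iff (cayley_den_ne_zero hq hw) (cayley_den_ne_zero hq hv)] at h
    have h2 : (w - v) * (q - (starRingEnd ℂ) q) = 0 := by linear_combination h
    have h3 : q - (starRingEnd ℂ) q ≠ 0 := cayley_den_ne_zero hq hq
    exact sub_eq_zero.1 ((mul_eq_zero.1 h2).resolve_right h3)
  · intro u hu
    rw [mem_ball_zero_iff] at hu
    have h1 : 1 - u ≠ 0 := fun h ↦ by
      rw [← sub_eq_zero.1 h] at hu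
      simp at hu
    have h3 : q - (starRingEnd ℂ) q ≠ 0 := cayley_den_ne_zero hq hq
    refine ⟨(q - (starRingEnd ℂ) q * u) / (1 - u), ?_, ?_⟩
    · have hu' : normSq u < 1 := by rw [normSq_eq_norm_sq]; nlinarith [norm_nonneg u]
      have hpos : 0 < normSq (1 - u) := normSq_pos.2 h1
      change 0 < ((q - (starRingEnd ℂ) q * u) / (1 - u)).im
      have : ((q - (starRingEnd ℂ) q * u) / (1 - u)).im = q.im * (1 - normSq u) / normSq (1 - u) := by
        rw [div_im]
        simp only [normSq_apply, sub_re, sub_im, mul_re, mul_im, one_re, one_im, conj_re, conj_im]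
        ring
      rw [this]
      exact div_pos (mul_pos hq (by linarith)) hpos
    · have e1 : (q - (starRingEnd ℂ) q * u) / (1 - u) - (starRingEnd ℂ) q =
          (q - (starRingEnd ℂ) q) / (1 - u) := by field_simp; ring
      have e2 : (q - (starRingEnd ℂ) q * u) / (1 - u) - q =
          u * (q - (starRingEnd ℂ) q) / (1 - u) := by field_simp; ring
      rw [cayley, e1, e2]
      field_simp

lemma isOpen_upperHalfPlaneSet : IsOpen UpperHalfPlane.upperHalfPlaneSet :=
  isOpen_lt continuous_const continuous_im

/-! ### The conformal radius -/

/-- Two Riemann maps with the same base point differ by a rotation, so a single `φ` determines the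
radius. This makes the arbitrary choice in `crad` harmless. -/
lemma isConformalRadius_iff {D : Set ℂ} (hD : IsOpen D) {z : ℂ} (hz : z ∈ D) {φ : ℂ → ℂ}
    (hφ : ConformalOnto φ D (ball 0 1)) (h0 : φ z = 0) (r : ℝ) :
    IsConformalRadius D z r ↔ r = ‖deriv φ z‖⁻¹ := by
  have hm : (0 : ℂ) ∈ ball (0 : ℂ) 1 := mem_ball_self one_pos
  constructor
  · rintro ⟨f, hf, hf0, rfl⟩
    have hrot := (hφ.comp hf).rotation (by simp [hf0, h0])
    have hd : deriv (φ ∘ f) 0 = deriv φ z * deriv f 0 := by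
      rw [deriv_comp, hf0]
      · rw [hf0]; exact hφ.1.differentiableAt (hD.mem_nhds hz)
      · exact hf.1.differentiableAt (isOpen_ball.mem_nhds hm)
    rw [hd, norm_mul] at hrot
    exact eq_inv_of_mul_eq_one_right hrot.1
  · rintro rfl
    obtain ⟨g, hg, hinv⟩ := hφ.symm hD
    refine ⟨g, hg, by rw [← h0, hinv.1 hz], ?_⟩
    have := hφ.deriv_mul_deriv hD hg hinv hz
    rw [h0] at this
    rw [← norm_inv, eq_inv_of_mul_eq_one_left this]

/-! ### Holomorphic square roots -/

/-- Every nowhere vanishing continuous function on `U` has a continuous square root. -/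
def HasSqrtBranches (U : Set ℂ) : Prop :=
  ∀ F : ℂ → ℂ, ContinuousOn F U → (∀ z ∈ U, F z ≠ 0) →
    ∃ s : ℂ → ℂ, ContinuousOn s U ∧ ∀ z ∈ U, s z ^ 2 = F z

/-- The slope of `s` is the slope of `F` divided by `s w + s z`, which tends to `2 s z ≠ 0`. -/
lemma differentiableOn_of_sq_eq {U : Set ℂ} (hU : IsOpen U) {F s : ℂ → ℂ}
    (hF : DifferentiableOn ℂ F U) (hF0 : ∀ z ∈ U, F z ≠ 0) (hs : ContinuousOn s U)
    (hsq : ∀ z ∈ U, s z ^ 2 = F z) : DifferentiableOn ℂ s U := by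
  intro z hz
  have hsz : s z ≠ 0 := fun h ↦ hF0 z hz (by rw [← hsq z hz, h]; simp)
  have hcont : ContinuousAt s z := hs.continuousAt (hU.mem_nhds hz)
  have hsum : Tendsto (fun w ↦ s w + s z) (𝓝 z) (𝓝 (s z + s z)) := hcont.tendsto.add_const _
  have hne : s z + s z ≠ 0 := by rw [← two_mul]; exact mul_ne_zero two_ne_zero hsz
  have hFd := (hF.differentiableAt (hU.mem_nhds hz)).hasDerivAt
  rw [hasDerivAt_iff_tendsto_slope] at hFd
  have h1 := hFd.div (hsum.mono_left nhdsWithin_le_nhds) hne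
  refine (HasDerivAt.differentiableAt (f' := deriv F z / (s z + s z)) ?_).differentiableWithinAt
  rw [hasDerivAt_iff_tendsto_slope]
  refine h1.congr' ?_
  filter_upwards [nhdsWithin_le_nhds (hsum.eventually_ne hne),
    nhdsWithin_le_nhds (hU.mem_nhds hz)] with w hw hwU
  rw [Pi.div_apply, slope_def_field, slope_def_field, ← hsq w hwU, ← hsq z hz, sq_sub_sq]
  field_simp

/-! ### Normal families -/

/-- The extension by zero of a function on a subtype. -/
noncomputable def zeroExtend (U : Set ℂ) (F : U → ℂ) (z : ℂ) : ℂ :=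
  open Classical in if h : z ∈ U then F ⟨z, h⟩ else 0

lemma zeroExtend_apply {U : Set ℂ} (F : U → ℂ) {z : ℂ} (hz : z ∈ U) :
    zeroExtend U F z = F ⟨z, hz⟩ := dif_pos hz

/-- Functions on `U` bounded by one, with the Lipschitz bounds that holomorphic functions bounded
by one enjoy. -/
def cauchyLipschitzFamily (U : Set ℂ) : Set (U → ℂ) :=
  {F | (∀ z, ‖F z‖ ≤ 1) ∧ ∀ (z w : U) (r : ℝ), 0 < r → ball (z : ℂ) r ⊆ U → (w : ℂ) ∈ ball (z : ℂ) r →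
    dist (F w) (F z) ≤ 2 / r * dist (w : ℂ) z}

/-- Tychonoff: the defining conditions are closed for pointwise convergence inside a product of
closed disks. -/
lemma isCompact_cauchyLipschitzFamily (U : Set ℂ) : IsCompact (cauchyLipschitzFamily U) := by
  have hK : IsCompact (Set.pi univ fun _ : U ↦ closedBall (0 : ℂ) 1) :=
    isCompact_univ_pi fun _ ↦ isCompact_closedBall 0 1
  refine hK.of_isClosed_subset ?_ fun F hF z _ ↦ mem_closedBall_zero_iff.2 (hF.1 z)
  simp only [cauchyLipschitzFamily, ofPred_and, ofPred_forall]
  refine IsClosed.inter (isClosed_iInter fun z ↦ ?_) ?_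
  · exact isClosed_le (continuous_apply z).norm continuous_const
  · refine isClosed_iInter fun z ↦ isClosed_iInter fun w ↦ isClosed_iInter fun r ↦
      isClosed_iInter fun _ ↦ isClosed_iInter fun _ ↦ isClosed_iInter fun _ ↦ ?_
    exact isClosed_le ((continuous_apply w).dist (continuous_apply z)) continuous_const

lemma equicontinuous_cauchyLipschitzFamily {U : Set ℂ} (hU : IsOpen U) :
    Equicontinuous ((↑) : cauchyLipschitzFamily U → U → ℂ) := by
  intro z
  rw [Metric.equicontinuousAt_iff]
  intro ε hε
  obtain ⟨r, hr, hrU⟩ := Metric.isOpen_iff.1 hU z z.2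
  refine ⟨min r (ε * r / 2), by positivity, fun w hw F ↦ ?_⟩
  rw [dist_comm (F.1 z)]
  have h1 : dist (w : ℂ) z < r := lt_of_lt_of_le hw (min_le_left _ _)
  have h2 : dist (w : ℂ) z < ε * r / 2 := lt_of_lt_of_le hw (min_le_right _ _)
  refine (F.2.2 z w r hr hrU h1).trans_lt ?_
  rw [div_mul_eq_mul_div, div_lt_iff₀ hr]
  linarith

/-- Montel's theorem in the form needed: by Arzelà–Ascoli, equicontinuity turns pointwise
compactness into compactness for locally uniform convergence. -/
lemma isCompact_continuousMap_cauchyLipschitzFamily {U : Set ℂ} (hU : IsOpen U) :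
    IsCompact {F : C(U, ℂ) | ⇑F ∈ cauchyLipschitzFamily U} := by
  refine ArzelaAscoli.isCompact_of_equicontinuous _ ?_ ?_
  · convert isCompact_cauchyLipschitzFamily U
    ext F
    constructor
    · rintro ⟨G, hG, rfl⟩
      exact hG
    · intro hF
      exact ⟨⟨F, (equicontinuous_cauchyLipschitzFamily hU).continuous ⟨F, hF⟩⟩, hF, rfl⟩
  · exact (equicontinuous_cauchyLipschitzFamily hU).comp
      fun F : {F : C(U, ℂ) | ⇑F ∈ cauchyLipschitzFamily U} ↦ ⟨F.1, F.2⟩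

lemma mem_cauchyLipschitzFamily {U : Set ℂ} {f : ℂ → ℂ} (hf : DifferentiableOn ℂ f U)
    (hb : ∀ z ∈ U, ‖f z‖ ≤ 1) : (fun z : U ↦ f z) ∈ cauchyLipschitzFamily U := by
  refine ⟨fun z ↦ hb z z.2, fun z w r hr hrU hw ↦ ?_⟩
  refine dist_le_div_mul_dist_of_mapsTo_ball (hf.mono hrU) (fun v hv ↦ ?_) hw
  rw [mem_closedBall]
  refine (dist_le_norm_add_norm _ _).trans ?_
  linarith [hb v (hrU hv), hb z z.2]

/-- **Hurwitz's theorem**: a nonconstant limit of injective holomorphic functions is injective. -/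
lemma injOn_of_tendstoLocallyUniformlyOn {ι : Type*} {l : Filter ι} [l.NeBot] {U : Set ℂ}
    (hU : IsOpen U) (hc : IsPreconnected U) {F : ι → ℂ → ℂ} {f : ℂ → ℂ}
    (hF : ∀ᶠ i in l, DifferentiableOn ℂ (F i) U ∧ InjOn (F i) U)
    (hlim : TendstoLocallyUniformlyOn F f l U) {z₀ z₁ : ℂ} (hz₀ : z₀ ∈ U) (hz₁ : z₁ ∈ U)
    (hne : f z₀ ≠ f z₁) : InjOn f U := by
  have hf : DifferentiableOn ℂ f U := hlim.differentiableOn (hF.mono fun _ h ↦ h.1) hU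
  have hA : AnalyticOnNhd ℂ f U := hf.analyticOnNhd hU
  intro a ha b hb hab
  by_contra hab'
  have hnc : ∀ᶠ z in 𝓝[≠] a, f z - f a ≠ 0 := by
    have hAa : AnalyticAt ℂ (fun z ↦ f z - f a) a := (hA a ha).sub analyticAt_const
    refine hAa.eventually_eq_zero_or_eventually_ne_zero.resolve_left fun h0 ↦ ?_
    have := hA.eqOn_of_preconnected_of_eventuallyEq (analyticOnNhd_const (v := f a)) hc ha
      (h0.mono fun z hz ↦ sub_eq_zero.1 hz)
    exact hne ((this hz₀).trans (this hz₁).symm)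
  rw [eventually_nhdsWithin_iff] at hnc
  obtain ⟨R, hR, hRU⟩ := Metric.eventually_nhds_iff_ball.1 (hnc.and (hU.mem_nhds ha))
  obtain ⟨r, hr0, hrR, hrb⟩ : ∃ r, 0 < r ∧ r < R ∧ r < dist b a := by
    have hpos : 0 < dist b a := dist_pos.2 (Ne.symm hab')
    exact ⟨min R (dist b a) / 2, by positivity, by
      have := min_le_left R (dist b a); linarith, by
      have := min_le_right R (dist b a); linarith⟩
  have hsub : closedBall a r ⊆ U := fun z hz ↦ (hRU z (closedBall_subset_ball hrR hz)).2
  obtain ⟨w, hw, hmin⟩ := (isCompact_sphere a r).exists_isMinOn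
    (NormedSpace.sphere_nonempty.2 hr0.le) (f := fun z ↦ ‖f z - f a‖)
    ((hf.continuousOn.mono (sphere_subset_closedBall.trans hsub)).sub continuousOn_const).norm
  set δ := ‖f w - f a‖ with hδdef
  have hδ : 0 < δ := norm_pos_iff.2 ((hRU w (sphere_subset_closedBall.trans
    (closedBall_subset_ball hrR) hw)).1 (fun h ↦ by
      rw [h] at hw; simp at hw; exact hr0.ne hw))
  have hunif : TendstoUniformlyOn F f l (closedBall a r) :=
    (tendstoLocallyUniformlyOn_iff_forall_isCompact hU).1 hlim _ hsub (isCompact_closedBall a r)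
  have hb' : Tendsto (fun i ↦ F i b) l (𝓝 (f b)) := hlim.tendsto_at hb
  obtain ⟨i, ⟨hid, hii⟩, hiu, hib⟩ := (hF.and ((Metric.tendstoUniformlyOn_iff.1 hunif (δ / 8)
    (by positivity)).and (Metric.tendsto_nhds.1 hb' (δ / 8) (by positivity)))).exists
  have hia := hiu a (mem_closedBall_self hr0.le)
  -- Quantitative open mapping: `F i` moves the circle at least `δ/2` away from `F i a`, so it
  -- covers the disk of radius `δ/4` from inside `closedBall a r`. That disk contains `F i b`, while
  -- `b` lies outside the closed ball, contradicting injectivity of `F i`.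
  have key := DiffContOnCl.ball_subset_image_closedBall (f := F i) (z₀ := a) (r := r)
    (ε := δ / 2) (hid.diffContOnCl_ball hsub) hr0 (fun z hz ↦ ?_) ?_
  · obtain ⟨v, hv, hve⟩ := key (show F i b ∈ ball (F i a) (δ / 2 / 2) by
      rw [mem_ball]
      have := dist_triangle4 (F i b) (f b) (f a) (F i a)
      rw [hab, dist_self] at this
      linarith [hab ▸ hia])
    have : v = b := hii (hsub hv) hb hve
    rw [this, mem_closedBall] at hv
    linarith
  · have h1 : δ ≤ ‖f z - f a‖ := hmin hz
    have h2 := hiu z (sphere_subset_closedBall hz)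
    rw [dist_eq_norm] at h2 hia
    have h3 : f z - f a = (f z - F i z) + (F i z - F i a) + -(f a - F i a) := by ring
    have h4 := norm_add₃_le (a := f z - F i z) (b := F i z - F i a) (c := -(f a - F i a))
    rw [← h3, norm_neg] at h4
    linarith
  · exact not_eventually.1 (not_eventually_const_of_injOn hU hii ha)

/-- Among the injective holomorphic maps of `U` into the disk sending `z₀` to the origin there is
one for which the modulus of the value at `z₁` is the largest. -/
lemma exists_extremal_injOn {U : Set ℂ} (hU : IsOpen U) (hc : IsPreconnected U) {z₀ z₁ : ℂ}
    (hz₀ : z₀ ∈ U) (hz₁ : z₁ ∈ U) (hne : z₁ ≠ z₀)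
    (hex : ∃ f : ℂ → ℂ, DifferentiableOn ℂ f U ∧ MapsTo f U (ball 0 1) ∧ InjOn f U ∧ f z₀ = 0) :
    ∃ f : ℂ → ℂ, (DifferentiableOn ℂ f U ∧ MapsTo f U (ball 0 1) ∧ InjOn f U ∧ f z₀ = 0) ∧
      ∀ g : ℂ → ℂ, DifferentiableOn ℂ g U → MapsTo g U (ball 0 1) → InjOn g U → g z₀ = 0 →
        ‖g z₁‖ ≤ ‖f z₁‖ := by
  have : LocallyCompactSpace U := hU.locallyCompactSpace
  set S : Set C(U, ℂ) := {F | DifferentiableOn ℂ (zeroExtend U F) U ∧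
    MapsTo (zeroExtend U F) U (ball 0 1) ∧ InjOn (zeroExtend U F) U ∧ zeroExtend U F z₀ = 0}
  have hSmem : ∀ g : ℂ → ℂ, DifferentiableOn ℂ g U → MapsTo g U (ball 0 1) → InjOn g U →
      g z₀ = 0 → ∃ G ∈ S, ∀ z (hz : z ∈ U), G ⟨z, hz⟩ = g z := by
    intro g hg hm hi h0
    have heq : EqOn (zeroExtend U fun z : U ↦ g z) g U := fun z hz ↦ zeroExtend_apply _ hz
    exact ⟨⟨fun z : U ↦ g z, hg.continuousOn.domRestrict⟩, ⟨hg.congr heq, hm.congr heq.symm,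
      hi.congr heq.symm, (heq hz₀).trans h0⟩, fun z hz ↦ rfl⟩
  have hSsub : S ⊆ {F : C(U, ℂ) | ⇑F ∈ cauchyLipschitzFamily U} := by
    rintro F ⟨hF1, hF2, -, -⟩
    have he : (fun z : U ↦ zeroExtend U F z) = F := funext fun z ↦ zeroExtend_apply F z.2
    have := mem_cauchyLipschitzFamily hF1 fun z hz ↦ (mem_ball_zero_iff.1 (hF2 hz)).le
    rwa [he] at this
  have hK := isCompact_continuousMap_cauchyLipschitzFamily hU
  have hScpt : IsCompact (closure S) :=
    hK.of_isClosed_subset isClosed_closure (closure_minimal hSsub hK.isClosed)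
  obtain ⟨f₀, hf₀, hm₀, hi₀, h₀⟩ := hex
  obtain ⟨F₀, hF₀S, hF₀⟩ := hSmem f₀ hf₀ hm₀ hi₀ h₀
  obtain ⟨F, hFS, hmax⟩ := hScpt.exists_isMaxOn ⟨F₀, subset_closure hF₀S⟩
    (f := fun F : C(U, ℂ) ↦ ‖F ⟨z₁, hz₁⟩‖)
    (continuous_eval_const (⟨z₁, hz₁⟩ : U)).norm.continuousOn
  have hmax' : ∀ g : ℂ → ℂ, DifferentiableOn ℂ g U → MapsTo g U (ball 0 1) → InjOn g U →
      g z₀ = 0 → ‖g z₁‖ ≤ ‖zeroExtend U F z₁‖ := by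
    intro g hg hm hi h0
    obtain ⟨G, hGS, hG⟩ := hSmem g hg hm hi h0
    rw [← hG z₁ hz₁, zeroExtend_apply F hz₁]
    exact hmax (subset_closure hGS)
  refine ⟨zeroExtend U F, ?_, hmax'⟩
  have : (𝓝[S] F).NeBot := mem_closure_iff_nhdsWithin_neBot.1 hFS
  have hlim : TendstoLocallyUniformlyOn (fun G : C(U, ℂ) ↦ zeroExtend U G) (zeroExtend U F)
      (𝓝[S] F) U := by
    rw [tendstoLocallyUniformlyOn_iff_tendstoLocallyUniformly_comp_coe]
    have := ContinuousMap.tendsto_iff_tendstoLocallyUniformly.1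
      (tendsto_id'.2 (nhdsWithin_le_nhds (a := F) (s := S)))
    convert! this using 1
    · ext G z
      exact zeroExtend_apply _ z.2
    · ext z
      exact zeroExtend_apply _ z.2
  have hSev : ∀ᶠ G in 𝓝[S] F, G ∈ S := self_mem_nhdsWithin
  have hdiff : DifferentiableOn ℂ (zeroExtend U F) U :=
    hlim.differentiableOn (hSev.mono fun _ h ↦ h.1) hU
  have hzero : zeroExtend U F z₀ = 0 :=
    tendsto_nhds_unique (hlim.tendsto_at hz₀)
      (tendsto_const_nhds.congr' (hSev.mono fun G hG ↦ hG.2.2.2.symm))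
  have hbd : ∀ z ∈ U, ‖zeroExtend U F z‖ ≤ 1 := fun z hz ↦
    le_of_tendsto (hlim.tendsto_at hz).norm
      (hSev.mono fun G hG ↦ (mem_ball_zero_iff.1 (hG.2.1 hz)).le)
  -- The maximum is at least `‖f₀ z₁‖ > 0`, so the limit is not constant and Hurwitz applies.
  have hz₁ne : zeroExtend U F z₀ ≠ zeroExtend U F z₁ := by
    rw [hzero]
    intro h
    have := hmax' f₀ hf₀ hm₀ hi₀ h₀
    rw [← h, norm_zero, norm_le_zero_iff, ← h₀] at this
    exact hne (hi₀ hz₁ hz₀ this)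
  have hinj := injOn_of_tendstoLocallyUniformlyOn hU hc (hSev.mono fun G hG ↦ ⟨hG.1, hG.2.2.1⟩)
    hlim hz₀ hz₁ hz₁ne
  refine ⟨hdiff, ?_, hinj, hzero⟩
  -- The limit maps a priori into the closed disk; its image is open, hence lies in the interior.
  have hop := isOpen_image_of_injOn hU hdiff hinj
  have hsub : zeroExtend U F '' U ⊆ closedBall 0 1 := by
    rintro _ ⟨z, hz, rfl⟩
    exact mem_closedBall_zero_iff.2 (hbd z hz)
  intro z hz
  have := hop.subset_interior_iff.2 hsub (mem_image_of_mem _ hz)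
  rwa [interior_closedBall _ one_ne_zero] at this

/-! ### The Riemann mapping theorem -/

lemma HasSqrtBranches.exists_injOn {U : Set ℂ} (hU : IsOpen U) (hs : HasSqrtBranches U)
    (hne : U ≠ univ) {z₀ : ℂ} (hz₀ : z₀ ∈ U) :
    ∃ f : ℂ → ℂ, DifferentiableOn ℂ f U ∧ MapsTo f U (ball 0 1) ∧ InjOn f U ∧ f z₀ = 0 := by
  obtain ⟨a, ha⟩ := (ne_univ_iff_exists_notMem _).1 hne
  have hF0 : ∀ z ∈ U, z - a ≠ 0 := fun z hz h ↦ ha (by rwa [← sub_eq_zero.1 h])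
  have hFd : DifferentiableOn ℂ (fun z : ℂ ↦ z - a) U := by fun_prop
  obtain ⟨s, hsc, hsq⟩ := hs _ hFd.continuousOn hF0
  have hsd := differentiableOn_of_sq_eq hU hFd hF0 hsc hsq
  have hsq_inj : ∀ z ∈ U, ∀ w ∈ U, s z ^ 2 = s w ^ 2 → z = w := by
    intro z hz w hw h
    rw [hsq z hz, hsq w hw] at h
    exact sub_left_injective h
  have hsi : InjOn s U := fun z hz w hw h ↦ hsq_inj z hz w hw (by rw [h])
  obtain ⟨ε, hε, hball⟩ := Metric.isOpen_iff.1 (isOpen_image_of_injOn hU hsd hsi) (s z₀)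
    (mem_image_of_mem s hz₀)
  -- A square root never takes both a value and its negative, so the image of `s` avoids the
  -- reflection of the disk about `s z₀`.
  have hfar : ∀ z ∈ U, ε ≤ ‖s z + s z₀‖ := by
    intro z hz
    by_contra! h
    obtain ⟨w, hw, hwe⟩ := hball (show -s z ∈ ball (s z₀) ε by
      rwa [mem_ball, dist_eq_norm, show -s z - s z₀ = -(s z + s z₀) by ring, norm_neg])
    have h1 : w = z := hsq_inj w hw z hz (by rw [hwe, neg_sq])
    subst h1
    have h2 : s w = 0 := by linear_combination hwe / 2
    exact hF0 w hw (by rw [← hsq w hw, h2]; simp)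
  have hden : ∀ z ∈ U, s z + s z₀ ≠ 0 := fun z hz ↦ norm_pos_iff.1 (hε.trans_le (hfar z hz))
  set f : ℂ → ℂ := fun z ↦ (ε / 2 : ℝ) / (s z + s z₀) with hf
  have hfd : DifferentiableOn ℂ f U :=
    (differentiableOn_const _).div (hsd.add_const _) hden
  have hfm : MapsTo f U (ball 0 1) := by
    intro z hz
    rw [mem_ball_zero_iff, hf, norm_div, norm_real, Real.norm_of_nonneg (by positivity),
      div_lt_one (hε.trans_le (hfar z hz))]
    linarith [hfar z hz]
  have hfi : InjOn f U := by
    intro z hz w hw h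
    have hε' : ((ε / 2 : ℝ) : ℂ) ≠ 0 := by exact_mod_cast (half_pos hε).ne'
    simp only [hf] at h
    rw [div_eq_div_iff (hden z hz) (hden w hw)] at h
    exact (hsi hw hz (add_right_cancel (mul_left_cancel₀ hε' h))).symm
  have hM := conformalOnto_diskMoebius (mem_ball_zero_iff.1 (hfm hz₀))
  exact ⟨diskMoebius (f z₀) ∘ f, hM.1.comp hfd hfm, hM.2.mapsTo.comp hfm,
    hM.2.injOn.comp hfi hfm, diskMoebius_self _⟩

/-- **Koebe's argument**: an injective map into the disk that is not onto can be improved. -/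
lemma HasSqrtBranches.exists_norm_lt {U : Set ℂ} (hU : IsOpen U) (hs : HasSqrtBranches U)
    {f : ℂ → ℂ} (hf : DifferentiableOn ℂ f U) (hm : MapsTo f U (ball 0 1)) (hi : InjOn f U)
    {z₀ z₁ : ℂ} (hz₀ : z₀ ∈ U) (hz₁ : z₁ ∈ U) (hne : z₁ ≠ z₀) (h0 : f z₀ = 0)
    (hsurj : ¬ SurjOn f U (ball 0 1)) :
    ∃ g : ℂ → ℂ, DifferentiableOn ℂ g U ∧ MapsTo g U (ball 0 1) ∧ InjOn g U ∧ g z₀ = 0 ∧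
      ‖f z₁‖ < ‖g z₁‖ := by
  obtain ⟨a, ha, hna⟩ := not_subset.1 hsurj
  have ha1 : ‖a‖ < 1 := mem_ball_zero_iff.1 ha
  have hTa := conformalOnto_diskMoebius ha1
  have hTna := conformalOnto_diskMoebius (show ‖-a‖ < 1 by simpa)
  have hFd : DifferentiableOn ℂ (diskMoebius a ∘ f) U := hTa.1.comp hf hm
  have hF0 : ∀ z ∈ U, (diskMoebius a ∘ f) z ≠ 0 := by
    intro z hz h
    refine hna ⟨z, hz, hTa.2.injOn (hm hz) ha ?_⟩
    rw [diskMoebius_self]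
    exact h
  obtain ⟨s, hsc, hsq⟩ := hs _ hFd.continuousOn hF0
  have hsd := differentiableOn_of_sq_eq hU hFd hF0 hsc hsq
  have hsm : MapsTo s U (ball 0 1) := by
    intro z hz
    rw [mem_ball_zero_iff, ← pow_lt_one_iff_of_nonneg (norm_nonneg _) two_ne_zero, ← norm_pow,
      hsq z hz]
    exact mem_ball_zero_iff.1 (hTa.2.mapsTo (hm hz))
  have hsi : InjOn s U := fun z hz w hw h ↦
    (hTa.2.injOn.comp hi hm) hz hw (by rw [← hsq z hz, ← hsq w hw, h])
  set b := s z₀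
  have hb1 : ‖b‖ < 1 := mem_ball_zero_iff.1 (hsm hz₀)
  have hTb := conformalOnto_diskMoebius hb1
  have hTnb := conformalOnto_diskMoebius (show ‖-b‖ < 1 by simpa)
  -- `Ψ` undoes the improvement: `f = Ψ ∘ (diskMoebius b ∘ s)`. It is a self-map of the disk fixing
  -- `0`, so Schwarz compares `‖f z₁‖` with the new value, strictly unless `Ψ` is linear.
  set Ψ : ℂ → ℂ := fun w ↦ diskMoebius (-a) (diskMoebius (-b) w ^ 2) with hΨ
  have hsqm : MapsTo (fun w : ℂ ↦ w ^ 2) (ball 0 1) (ball 0 1) := by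
    intro w hw
    rw [mem_ball_zero_iff] at hw ⊢
    rw [norm_pow]
    exact pow_lt_one₀ (norm_nonneg _) hw two_ne_zero
  have hΨd : DifferentiableOn ℂ Ψ (ball 0 1) :=
    hTna.1.comp (hTnb.1.pow 2) (hsqm.comp hTnb.2.mapsTo)
  have hΨm : MapsTo Ψ (ball 0 1) (ball 0 1) := hTna.2.mapsTo.comp (hsqm.comp hTnb.2.mapsTo)
  have hΨf : ∀ z ∈ U, Ψ (diskMoebius b (s z)) = f z := by
    intro z hz
    simp only [hΨ]
    rw [diskMoebius_neg_diskMoebius hb1 (mem_ball_zero_iff.1 (hsm hz)), hsq z hz]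
    exact diskMoebius_neg_diskMoebius ha1 (mem_ball_zero_iff.1 (hm hz))
  have hΨ0 : Ψ 0 = 0 := by
    have := hΨf z₀ hz₀
    rwa [show s z₀ = b from rfl, diskMoebius_self, h0] at this
  refine ⟨diskMoebius b ∘ s, hTb.1.comp hsd hsm, hTb.2.mapsTo.comp hsm,
    hTb.2.injOn.comp hsi hsm, diskMoebius_self _, ?_⟩
  set w := (diskMoebius b ∘ s) z₁ with hw
  have hwm : w ∈ ball (0 : ℂ) 1 := hTb.2.mapsTo (hsm hz₁)
  have hfw : f z₁ = Ψ w := (hΨf z₁ hz₁).symm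
  have hw0 : w ≠ 0 := fun h ↦ hne (hi hz₁ hz₀ (by rw [hfw, h, hΨ0, h0]))
  have hΨcl : MapsTo Ψ (ball 0 1) (closedBall (Ψ 0) 1) := by
    rw [hΨ0]
    exact hΨm.mono_right ball_subset_closedBall
  have hle : ‖Ψ w‖ ≤ ‖w‖ := by
    simpa [hΨ0] using dist_le_dist_of_mapsTo_ball hΨd hΨcl hwm
  rw [hfw]
  refine hle.lt_of_ne fun heq ↦ ?_
  have hslope : ‖dslope Ψ 0 w‖ = 1 / 1 := by
    rw [dslope_of_ne _ hw0, slope_def_field, hΨ0, sub_zero, sub_zero, norm_div, heq,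
      div_self (norm_ne_zero_iff.2 hw0), div_one]
  have haff := affine_of_mapsTo_ball_of_norm_dslope_eq_div hΨd hΨcl hwm hslope
  have hd0 : dslope Ψ 0 w ≠ 0 := norm_pos_iff.1 (by rw [hslope]; norm_num)
  -- The squaring inside `Ψ` identifies the images of `1/2` and `-1/2`, so `Ψ` is not injective and
  -- cannot be a nonzero linear map.
  have hp : (1 / 2 : ℂ) ∈ ball (0 : ℂ) 1 := by rw [mem_ball_zero_iff]; norm_num
  have hq : (-(1 / 2) : ℂ) ∈ ball (0 : ℂ) 1 := by rw [mem_ball_zero_iff]; norm_num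
  have hval : ∀ v ∈ ball (0 : ℂ) 1, Ψ (diskMoebius b v) = diskMoebius (-a) (v ^ 2) := by
    intro v hv
    simp only [hΨ]
    rw [diskMoebius_neg_diskMoebius hb1 (mem_ball_zero_iff.1 hv)]
  have e1 := haff (hTb.2.mapsTo hp)
  have e2 := haff (hTb.2.mapsTo hq)
  have e3 : Ψ (diskMoebius b (1 / 2)) = Ψ (diskMoebius b (-(1 / 2))) := by
    rw [hval _ hp, hval _ hq, neg_sq]
  rw [e1, e2] at e3
  simp only [sub_zero, smul_eq_mul] at e3
  have e4 := hTb.2.injOn hp hq (mul_right_cancel₀ hd0 (add_left_cancel e3))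
  norm_num at e4

/-- The **Riemann mapping theorem**. -/
theorem HasSqrtBranches.exists_conformalOnto {U : Set ℂ} (hU : IsOpen U) (hc : IsPreconnected U)
    (hs : HasSqrtBranches U) (hne : U ≠ univ) {z₀ : ℂ} (hz₀ : z₀ ∈ U) :
    ∃ f : ℂ → ℂ, ConformalOnto f U (ball 0 1) ∧ f z₀ = 0 := by
  obtain ⟨r, hr, hrU⟩ := Metric.isOpen_iff.1 hU z₀ hz₀
  have hz₁ : z₀ + (r / 2 : ℝ) ∈ U := hrU (by
    rw [mem_ball, dist_eq_norm, add_sub_cancel_left, norm_real, Real.norm_of_nonneg (by positivity)]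
    linarith)
  have hne₁ : z₀ + (r / 2 : ℝ) ≠ z₀ := by
    have : ((r / 2 : ℝ) : ℂ) ≠ 0 := by exact_mod_cast (half_pos hr).ne'
    simpa using this
  obtain ⟨f, ⟨hf, hm, hi, h0⟩, hmax⟩ :=
    exists_extremal_injOn hU hc hz₀ hz₁ hne₁ (hs.exists_injOn hU hne hz₀)
  refine ⟨f, ⟨hf, hm, hi, ?_⟩, h0⟩
  by_contra hsurj
  obtain ⟨g, hg, hgm, hgi, hg0, hlt⟩ := hs.exists_norm_lt hU hf hm hi hz₀ hz₁ hne₁ h0 hsurj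
  exact hlt.not_ge (hmax g hg hgm hgi hg0)

/-! ### Typically real functions -/

section TypicallyReal

variable {T : ℂ → ℂ} {R : ℝ}

/-- On `|w| = s` one has `s² - w² = w (conj w - w)`, so the real part of `(s² - w²) T w / w` is `2
Im w Im (T w) ≥ 0`. The maximum principle for the exponential of its negative carries this inside,
and then `s → R`. -/
lemma re_nonneg_of_typicallyReal (hT : DifferentiableOn ℂ T (ball 0 R)) (hT0 : T 0 = 0)
    (hpos : ∀ ζ ∈ ball (0 : ℂ) R, 0 ≤ ζ.im * (T ζ).im) {ζ : ℂ} (hζ : ζ ∈ ball (0 : ℂ) R) :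
    0 ≤ (((R : ℂ) ^ 2 - ζ ^ 2) * dslope T 0 ζ).re := by
  have hR : 0 < R := pos_of_mem_ball hζ
  have hD : DifferentiableOn ℂ (dslope T 0) (ball 0 R) :=
    (differentiableOn_dslope (ball_mem_nhds 0 hR)).2 hT
  have hζR : ‖ζ‖ < R := mem_ball_zero_iff.1 hζ
  have key : ∀ s, ‖ζ‖ < s → s < R → 0 ≤ (((s : ℂ) ^ 2 - ζ ^ 2) * dslope T 0 ζ).re := by
    intro s hζs hsR
    have hs : 0 < s := (norm_nonneg _).trans_lt hζs
    have hp : DifferentiableOn ℂ (fun w ↦ exp (-(((s : ℂ) ^ 2 - w ^ 2) * dslope T 0 w)))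
        (ball 0 R) := by fun_prop
    have hle := norm_le_of_forall_mem_frontier_norm_le (isBounded_ball (x := (0 : ℂ)) (r := s))
      (hp.diffContOnCl_ball (closedBall_subset_ball hsR)) (C := 1) ?_
      (subset_closure (mem_ball_zero_iff.2 hζs))
    · rw [norm_exp, ← Real.exp_zero, Real.exp_le_exp, neg_re] at hle
      linarith
    · intro w hw
      rw [frontier_ball _ hs.ne', mem_sphere_zero_iff_norm] at hw
      have hw0 : w ≠ 0 := norm_pos_iff.1 (hw ▸ hs)
      have hwR : w ∈ ball (0 : ℂ) R := by rw [mem_ball_zero_iff, hw]; exact hsR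
      have hs2 : (s : ℂ) ^ 2 = w * (starRingEnd ℂ) w := by
        rw [mul_conj, normSq_eq_norm_sq, hw]; push_cast; ring
      have : ((s : ℂ) ^ 2 - w ^ 2) * dslope T 0 w = ((starRingEnd ℂ) w - w) * T w := by
        rw [dslope_of_ne _ hw0, slope_def_field, hT0, hs2]
        field_simp
        ring
      rw [norm_exp, ← Real.exp_zero, Real.exp_le_exp, this]
      simp only [neg_re, mul_re, sub_re, conj_re, sub_im, conj_im]
      nlinarith [hpos w hwR]
  have hcont : Tendsto (fun s : ℝ ↦ (((s : ℂ) ^ 2 - ζ ^ 2) * dslope T 0 ζ).re) (𝓝[<] R)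
      (𝓝 ((((R : ℂ) ^ 2 - ζ ^ 2) * dslope T 0 ζ).re)) := by
    have : Continuous (fun s : ℝ ↦ (((s : ℂ) ^ 2 - ζ ^ 2) * dslope T 0 ζ).re) := by fun_prop
    exact this.continuousAt.tendsto.mono_left nhdsWithin_le_nhds
  refine ge_of_tendsto hcont ?_
  filter_upwards [Ioo_mem_nhdsLT hζR] with s hs using key s hs.1 hs.2

/-- A typically real function on a disk is close to its linear part. -/
lemma norm_sub_le_of_typicallyReal (hR : 0 < R) (hT : DifferentiableOn ℂ T (ball 0 R))
    (hT0 : T 0 = 0) (hpos : ∀ ζ ∈ ball (0 : ℂ) R, 0 ≤ ζ.im * (T ζ).im) {h : ℝ}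
    (hh : deriv T 0 = h) :
    0 ≤ h ∧ ∀ ζ : ℂ, ‖ζ‖ ≤ R / 2 → ‖T ζ - h * ζ‖ ≤ 6 * h * ‖ζ‖ ^ 2 / R := by
  have hR' : (R : ℂ) ≠ 0 := by exact_mod_cast hR.ne'
  have hD : DifferentiableOn ℂ (dslope T 0) (ball 0 R) :=
    (differentiableOn_dslope (ball_mem_nhds 0 hR)).2 hT
  set p : ℂ → ℂ := fun ζ ↦ (1 - ζ ^ 2 / (R : ℂ) ^ 2) * dslope T 0 ζ with hp
  have hpd : DifferentiableOn ℂ (fun ζ ↦ h - p ζ) (ball 0 R) := by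
    simp only [hp]; fun_prop
  have hp0 : p 0 = h := by simp [hp, hh]
  have hpre : ∀ ζ ∈ ball (0 : ℂ) R, 0 ≤ (p ζ).re := by
    intro ζ hζ
    have h1 := re_nonneg_of_typicallyReal hT hT0 hpos hζ
    have h2 : p ζ = ((R ^ 2)⁻¹ : ℝ) * (((R : ℂ) ^ 2 - ζ ^ 2) * dslope T 0 ζ) := by
      simp only [hp]; push_cast; field_simp
    rw [h2, re_ofReal_mul]
    positivity
  have h0 : 0 ≤ h := by simpa [hp0] using hpre 0 (mem_ball_self hR)
  refine ⟨h0, fun ζ hζ ↦ ?_⟩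
  have hζR : ‖ζ‖ < R := by linarith
  have hbc : ‖h - p ζ‖ ≤ 2 * h * ‖ζ‖ / (R - ‖ζ‖) := by
    -- `Re (h - p) ≤ h`. Taking `M > h` keeps the Borel–Carathéodory bound positive even when `h =
    -- 0`.
    have hM : ∀ M : ℝ, h < M → ‖h - p ζ‖ ≤ 2 * M * ‖ζ‖ / (R - ‖ζ‖) := by
      intro M hM
      refine borelCaratheodory_zero (h0.trans_lt hM) hpd (fun w hw ↦ ?_) hR
        (mem_ball_zero_iff.2 hζR) (by simp [hp0])
      have := hpre w hw
      simp only [mem_ofPred_eq, sub_re, ofReal_re]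
      linarith
    have hcont : Tendsto (fun M : ℝ ↦ 2 * M * ‖ζ‖ / (R - ‖ζ‖)) (𝓝[>] h)
        (𝓝 (2 * h * ‖ζ‖ / (R - ‖ζ‖))) := by
      have : Continuous (fun M : ℝ ↦ 2 * M * ‖ζ‖ / (R - ‖ζ‖)) := by fun_prop
      exact this.continuousAt.tendsto.mono_left nhdsWithin_le_nhds
    exact ge_of_tendsto hcont (by filter_upwards [self_mem_nhdsWithin] with M hM' using hM M hM')
  have hTD : T ζ = ζ * dslope T 0 ζ := by
    simpa [hT0] using (sub_smul_dslope T 0 ζ).symm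
  have hq : ‖ζ ^ 2 / (R : ℂ) ^ 2‖ = (‖ζ‖ / R) ^ 2 := by
    rw [norm_div, norm_pow, norm_pow, norm_real, Real.norm_of_nonneg hR.le, div_pow]
  set t := ‖ζ‖ / R with ht
  have ht0 : 0 ≤ t := by positivity
  have ht2 : t ≤ 1 / 2 := by rw [ht, div_le_iff₀ hR]; linarith
  have hbc' : ‖h - p ζ‖ ≤ 4 * h * t := by
    refine hbc.trans ?_
    rw [ht, div_le_iff₀ (by linarith)]
    have : 4 * h * (‖ζ‖ / R) * (R - ‖ζ‖) = 4 * h * ‖ζ‖ * (1 - t) := by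
      rw [ht]; field_simp
    rw [this]
    have : 0 ≤ h * ‖ζ‖ := by positivity
    nlinarith
  have hid : (1 - ζ ^ 2 / (R : ℂ) ^ 2) * (dslope T 0 ζ - h) = -(h - p ζ) + h * (ζ ^ 2 / (R : ℂ) ^ 2) := by
    simp only [hp]; ring
  have hlow : 3 / 4 ≤ ‖1 - ζ ^ 2 / (R : ℂ) ^ 2‖ := by
    have := norm_sub_norm_le 1 (ζ ^ 2 / (R : ℂ) ^ 2)
    rw [hq, norm_one] at this
    nlinarith
  have hup : ‖-(h - p ζ) + h * (ζ ^ 2 / (R : ℂ) ^ 2)‖ ≤ 4 * h * t + h * t ^ 2 := by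
    refine (norm_add_le _ _).trans ?_
    rw [norm_neg, norm_mul, hq, norm_real, Real.norm_of_nonneg h0]
    linarith
  rw [← hid, norm_mul] at hup
  have hht : 0 ≤ h * t := by positivity
  -- With `t ≤ 1/2`, `4 h t + h t² ≤ (9/2) h t`, and division by `3/4` gives the constant `6`.
  have hmain : ‖dslope T 0 ζ - h‖ ≤ 6 * h * t := by
    nlinarith [norm_nonneg (dslope T 0 ζ - h)]
  have : T ζ - h * ζ = ζ * (dslope T 0 ζ - h) := by rw [hTD]; ring
  rw [this, norm_mul]
  calc ‖ζ‖ * ‖dslope T 0 ζ - h‖ ≤ ‖ζ‖ * (6 * h * t) := by gcongr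
    _ = 6 * h * ‖ζ‖ ^ 2 / R := by rw [ht]; ring

end TypicallyReal

/-! ### Gluing square roots -/

namespace HasSqrtBranches

variable {U V : Set ℂ}

lemma of_isSimplyConnected (hU : IsOpen U) (h : IsSimplyConnected U) : HasSqrtBranches U := by
  intro F hF hF0
  obtain ⟨s, hs, hsq⟩ := exists_continuousOn_pow_eq h hU hF
    (by rintro ⟨z, hz, h0⟩; exact hF0 z hz h0) two_ne_zero
  exact ⟨s, hs, fun z _ ↦ hsq z⟩

lemma of_ball (c : ℂ) (r : ℝ) : HasSqrtBranches (ball c r) := by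
  rcases (ball c r).eq_empty_or_nonempty with h | h
  · intro F _ _
    exact ⟨F, by simp [h], by simp [h]⟩
  · have := (convex_ball c r).contractibleSpace h
    exact of_isSimplyConnected isOpen_ball (SimplyConnectedSpace.ofContractible _)

/-- Only continuity of `e` is asked, so this serves both the inversion and complex conjugation. -/
lemma of_involution {e : ℂ → ℂ} (hs : HasSqrtBranches U) (heU : ContinuousOn e U)
    (heV : ContinuousOn e V) (hUV : MapsTo e U V) (hVU : MapsTo e V U)
    (hinv : ∀ z ∈ V, e (e z) = z) : HasSqrtBranches V := by
  intro F hF hF0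
  obtain ⟨s, hsc, hsq⟩ := hs (F ∘ e) (hF.comp heU hUV) fun z hz ↦ hF0 _ (hUV hz)
  refine ⟨s ∘ e, hsc.comp heV hVU, fun z hz ↦ ?_⟩
  rw [Function.comp_apply, hsq _ (hVU hz), Function.comp_apply, hinv z hz]

/-- On a preconnected overlap two branches agree up to one global sign, which can be absorbed into
the second branch. -/
lemma union (hU : IsOpen U) (hV : IsOpen V) (hsU : HasSqrtBranches U) (hsV : HasSqrtBranches V)
    (hc : IsPreconnected (U ∩ V)) : HasSqrtBranches (U ∪ V) := by
  intro F hF hF0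
  obtain ⟨s, hsc, hsq⟩ := hsU F (hF.mono subset_union_left) fun z hz ↦ hF0 z (Or.inl hz)
  obtain ⟨t, htc, htq⟩ : ∃ t : ℂ → ℂ, ContinuousOn t V ∧ (∀ z ∈ V, t z ^ 2 = F z) ∧
      EqOn s t (U ∩ V) := by
    obtain ⟨t, htc, htq⟩ := hsV F (hF.mono subset_union_right) fun z hz ↦ hF0 z (Or.inr hz)
    rcases hc.eq_or_eq_neg_of_sq_eq (hsc.mono inter_subset_left) (htc.mono inter_subset_right)
      (fun z hz ↦ by simp [hsq z hz.1, htq z hz.2]) (fun {z} hz h ↦ hF0 z (Or.inl hz.1) (by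
        rw [← htq z hz.2, h]; simp)) with h | h
    · exact ⟨t, htc, htq, h⟩
    · exact ⟨-t, htc.neg, fun z hz ↦ by simp [htq z hz], h⟩
  classical
  set q : ℂ → ℂ := U.piecewise s t with hq
  have hqU : EqOn q s U := fun z hz ↦ piecewise_eq_of_mem _ _ _ hz
  have hqV : EqOn q t V := by
    intro z hz
    by_cases hzU : z ∈ U
    · rw [hqU hzU, htq.2 ⟨hzU, hz⟩]
    · exact piecewise_eq_of_notMem _ _ _ hzU
  refine ⟨q, ContinuousOn.union_of_isOpen (hsc.congr hqU) (htc.congr hqV) hU hV, ?_⟩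
  rintro z (hz | hz)
  · rw [hqU hz, hsq z hz]
  · rw [hqV hz, htq.1 z hz]

end HasSqrtBranches

lemma ConformalOnto.congr {f g : ℂ → ℂ} {U V : Set ℂ} (hf : ConformalOnto f U V)
    (h : EqOn g f U) : ConformalOnto g U V :=
  ⟨hf.1.congr h, hf.2.congr h.symm⟩

/-! ### Symmetric Riemann maps -/

lemma dslope_conj {f : ℂ → ℂ} {Ω : Set ℂ} (hΩ : Ω ∈ 𝓝 0)
    (hf : ∀ ζ ∈ Ω, f (conj ζ) = conj (f ζ)) {ζ : ℂ} (hζ : ζ ∈ Ω) :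
    dslope f 0 (conj ζ) = conj (dslope f 0 ζ) := by
  have h0 : f 0 = conj (f 0) := by simpa using hf 0 (mem_of_mem_nhds hΩ)
  rcases eq_or_ne ζ 0 with rfl | hne
  · have he : (conj ∘ f ∘ conj) =ᶠ[𝓝 0] f := by
      filter_upwards [hΩ] with w hw
      simp [hf w hw]
    have := he.deriv_eq
    rw [deriv_conj_conj] at this
    simpa using this.symm
  · have hne' : conj ζ ≠ 0 := by simpa using hne
    rw [dslope_of_ne _ hne, dslope_of_ne _ hne', slope_def_field, slope_def_field, hf ζ hζ]
    simp only [map_div₀, map_sub, ← h0, map_zero]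

/-- `Φ` maps the domain `Ω`, which is symmetric about the real axis, conformally onto the disk,
respecting the symmetry and with derivative `c > 0` at the origin. -/
structure IsSymmetricRiemannMap (Ω : Set ℂ) (Φ : ℂ → ℂ) (c : ℝ) : Prop where
  isOpen : IsOpen Ω
  zero_mem : (0 : ℂ) ∈ Ω
  conj_mem : ∀ ζ ∈ Ω, conj ζ ∈ Ω
  conformal : ConformalOnto Φ Ω (ball 0 1)
  map_zero : Φ 0 = 0
  deriv_zero : deriv Φ 0 = c
  pos : 0 < c
  map_conj : ∀ ζ ∈ Ω, Φ (conj ζ) = conj (Φ ζ)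
  im_pos : ∀ ζ ∈ Ω, 0 < ζ.im → 0 < (Φ ζ).im

lemma ball_conj_mem {r : ℝ} {w : ℂ} (hw : w ∈ ball (0 : ℂ) r) : conj w ∈ ball (0 : ℂ) r := by
  simpa using hw

/-- After a rotation the derivative at `0` is positive. Then `conj ∘ Φ ∘ conj` is a Riemann map with
the same derivative, so it equals `Φ`. By injectivity `Φ` is not real at points of the upper part,
which is connected, and the sign of `Im Φ` there is read off on the imaginary axis near `0`. -/
lemma exists_isSymmetricRiemannMap {Ω : Set ℂ} (hΩ : IsOpen Ω) (h0 : (0 : ℂ) ∈ Ω)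
    (hconj : ∀ ζ ∈ Ω, conj ζ ∈ Ω) (hupper : IsPreconnected (Ω ∩ upperHalfPlaneSet))
    (hex : ∃ f : ℂ → ℂ, ConformalOnto f Ω (ball 0 1) ∧ f 0 = 0) :
    ∃ Φ c, IsSymmetricRiemannMap Ω Φ c := by
  obtain ⟨f, hf, hf0⟩ := hex
  set a := deriv f 0 with ha
  have ha0 : a ≠ 0 := hf.deriv_ne_zero hΩ h0
  have hna : 0 < ‖a‖ := norm_pos_iff.2 ha0
  have hna' : (‖a‖ : ℂ) ≠ 0 := by exact_mod_cast hna.ne'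
  set κ : ℂ := conj a / ‖a‖ with hκ
  have hκ1 : ‖κ‖ = 1 := by
    rw [hκ, norm_div, RCLike.norm_conj, norm_real, norm_norm, div_self hna.ne']
  have hκ0 : κ ≠ 0 := norm_pos_iff.1 (by rw [hκ1]; norm_num)
  set Φ : ℂ → ℂ := fun ζ ↦ κ * f ζ with hΦ
  have hΦc : ConformalOnto Φ Ω (ball 0 1) := by
    refine ⟨hf.1.const_mul κ, fun ζ hζ ↦ ?_, fun ζ hζ w hw h ↦ ?_, fun u hu ↦ ?_⟩
    · have := hf.2.mapsTo hζ
      rw [mem_ball_zero_iff] at this ⊢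
      rwa [hΦ, norm_mul, hκ1, one_mul]
    · exact hf.2.injOn hζ hw (mul_left_cancel₀ hκ0 h)
    · rw [mem_ball_zero_iff] at hu
      obtain ⟨ζ, hζ, h⟩ := hf.2.surjOn (show κ⁻¹ * u ∈ ball (0 : ℂ) 1 by
        rwa [mem_ball_zero_iff, norm_mul, norm_inv, hκ1, inv_one, one_mul])
      exact ⟨ζ, hζ, by simp only [hΦ, h]; field_simp⟩
  have hΦ0 : Φ 0 = 0 := by simp [hΦ, hf0]
  have hΦd : HasDerivAt Φ (‖a‖ : ℂ) 0 := by
    have h1 := (hf.1.differentiableAt (hΩ.mem_nhds h0)).hasDerivAt.const_mul κ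
    have h2 : κ * a = ‖a‖ := by
      rw [hκ, div_mul_eq_mul_div, mul_comm, mul_conj, normSq_eq_norm_sq]
      push_cast
      field_simp
    rwa [← ha, h2] at h1
  have hΦs : ConformalOnto (conj ∘ Φ ∘ conj) Ω (ball 0 1) := by
    refine ⟨fun ζ hζ ↦ ?_, fun ζ hζ ↦ ball_conj_mem (hΦc.2.mapsTo (hconj ζ hζ)),
      fun ζ hζ w hw h ↦ ?_, fun u hu ↦ ?_⟩
    · exact (differentiableAt_conj_conj_iff.2
        (hΦc.1.differentiableAt (hΩ.mem_nhds (hconj ζ hζ)))).differentiableWithinAt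
    · have h2 := (starRingEnd ℂ).injective h
      exact (starRingEnd ℂ).injective (hΦc.2.injOn (hconj ζ hζ) (hconj w hw) h2)
    · obtain ⟨ζ, hζ, h⟩ := hΦc.2.surjOn (ball_conj_mem hu)
      exact ⟨conj ζ, hconj ζ hζ, by simp [h]⟩
  have hsymm : ∀ ζ ∈ Ω, Φ (conj ζ) = conj (Φ ζ) := by
    obtain ⟨g, hg, hinv⟩ := hΦc.symm hΩ
    have hg0 : g 0 = 0 := by simpa [hΦ0] using hinv.1 h0
    have hrot := ((hΦs.comp hg).rotation (by simp [hg0, hΦ0])).2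
    have hd := hg.1.differentiableAt (isOpen_ball.mem_nhds (mem_ball_self one_pos))
    have hgd : deriv g 0 = (‖a‖ : ℂ)⁻¹ := by
      have := hΦc.deriv_mul_deriv hΩ hg hinv h0
      rw [hΦ0, hΦd.deriv] at this
      exact eq_inv_of_mul_eq_one_left this
    have hdΦ : HasDerivAt (conj ∘ Φ ∘ conj) (‖a‖ : ℂ) (g 0) := by
      rw [hg0, hasDerivAt_conj_conj_iff]
      simpa using hΦd
    have hd1 : deriv ((conj ∘ Φ ∘ conj) ∘ g) 0 = 1 := by
      rw [(hdΦ.comp 0 hd.hasDerivAt).deriv, hgd, mul_inv_cancel₀ hna']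
    intro ζ hζ
    have h1 := hrot _ (hΦc.2.mapsTo hζ)
    rw [hd1, one_mul, Function.comp_apply, hinv.1 hζ] at h1
    rw [← h1]
    simp
  have hne : ∀ ζ ∈ Ω, 0 < ζ.im → (Φ ζ).im ≠ 0 := by
    intro ζ hζ him h
    have h1 : conj (Φ ζ) = Φ ζ := conj_eq_iff_im.2 h
    rw [← hsymm ζ hζ] at h1
    have := conj_eq_iff_im.1 (hΦc.2.injOn (hconj ζ hζ) hζ h1)
    linarith
  have hex : ∃ ζ ∈ Ω, 0 < ζ.im ∧ 0 < (Φ ζ).im := by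
    have hl : HasDerivAt (fun t : ℝ ↦ Φ (t * I)) (‖a‖ * I) 0 := by
      have h1 : HasDerivAt (fun t : ℂ ↦ t * I) I ((0 : ℝ) : ℂ) := by
        simpa using (hasDerivAt_id ((0 : ℝ) : ℂ)).mul_const I
      have h2 : HasDerivAt Φ (‖a‖ : ℂ) (((0 : ℝ) : ℂ) * I) := by simpa using hΦd
      exact (HasDerivAt.comp ((0 : ℝ) : ℂ) h2 h1).comp_ofReal
    rw [hasDerivAt_iff_tendsto_slope] at hl
    have h3 : Tendsto (fun t : ℝ ↦ (slope (fun t : ℝ ↦ Φ (t * I)) 0 t).im) (𝓝[>] 0) (𝓝 ‖a‖) := by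
      have := (continuous_im.tendsto _).comp (hl.mono_left (nhdsGT_le_nhdsNE 0))
      simpa [Function.comp_def] using this
    have h4 : Tendsto (fun t : ℝ ↦ (t : ℂ) * I) (𝓝[>] 0) (𝓝 0) := by
      have : Continuous fun t : ℝ ↦ (t : ℂ) * I := by fun_prop
      have := this.tendsto 0
      simp only [ofReal_zero, zero_mul] at this
      exact this.mono_left nhdsWithin_le_nhds
    obtain ⟨t, ht1, ht2, ht3⟩ := ((h3.eventually (lt_mem_nhds hna)).and
      ((h4.eventually (hΩ.mem_nhds h0)).and self_mem_nhdsWithin)).exists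
    have ht0 : 0 < t := ht3
    refine ⟨t * I, ht2, by simpa using ht0, ?_⟩
    simp only [slope_def_module, ofReal_zero, zero_mul, hΦ0, sub_zero, real_smul,
      im_ofReal_mul] at ht1
    exact pos_of_mul_pos_right ht1 (by positivity)
  refine ⟨Φ, ‖a‖, hΩ, h0, hconj, hΦc, hΦ0, hΦd.deriv, hna, hsymm, fun ζ hζ him ↦ ?_⟩
  by_contra! hcon
  obtain ⟨ζ', hζ', him', hpos⟩ := hex
  have hcont : ContinuousOn (fun ζ ↦ (Φ ζ).im) (Ω ∩ upperHalfPlaneSet) :=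
    continuous_im.comp_continuousOn (hΦc.1.continuousOn.mono inter_subset_left)
  obtain ⟨w, hw, hw0⟩ := hupper.intermediate_value ⟨hζ, him⟩ ⟨hζ', him'⟩ hcont
    (show (0 : ℝ) ∈ Icc _ _ from ⟨hcon, hpos.le⟩)
  exact hne w hw.1 hw.2 hw0

/-! ### The Joukowski map -/

lemma im_inv_add_self (u : ℂ) : (u⁻¹ + u).im = u.im * (1 - (normSq u)⁻¹) := by
  rw [add_im, inv_im]
  ring

lemma conformalOnto_joukowski {c : ℝ} (hc : 0 < c) (b : ℝ) :
    ConformalOnto (fun u ↦ -(c * (u⁻¹ + u)) - b) (ball 0 1 ∩ upperHalfPlaneSet)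
      upperHalfPlaneSet := by
  have hc' : (c : ℂ) ≠ 0 := by exact_mod_cast hc.ne'
  have hne : ∀ u ∈ ball (0 : ℂ) 1 ∩ upperHalfPlaneSet, u ≠ 0 := by
    rintro u ⟨-, hu⟩ rfl
    exact lt_irrefl (0 : ℝ) hu
  refine ⟨fun u hu ↦ ?_, fun u hu ↦ ?_, fun u hu v hv h ↦ ?_, fun t ht ↦ ?_⟩
  · have := hne u hu
    exact DifferentiableAt.differentiableWithinAt (by fun_prop (disch := assumption))
  · have hn : normSq u < 1 := by
      have := mem_ball_zero_iff.1 hu.1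
      rw [normSq_eq_norm_sq]
      nlinarith [norm_nonneg u]
    have hn1 : 1 < (normSq u)⁻¹ := (one_lt_inv₀ (normSq_pos.2 (hne u hu))).2 hn
    have him : 0 < u.im := hu.2
    change 0 < (-(c * (u⁻¹ + u)) - b : ℂ).im
    rw [sub_im, neg_im, im_ofReal_mul, im_inv_add_self, ofReal_im]
    nlinarith [mul_pos hc him]
  · have hu0 := hne u hu
    have hv0 := hne v hv
    have h1 : u⁻¹ + u = v⁻¹ + v := mul_left_cancel₀ hc' (neg_injective (sub_left_injective h))
    have h2 : (u - v) * (u * v - 1) = 0 := by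
      field_simp at h1
      linear_combination h1
    rcases mul_eq_zero.1 h2 with h3 | h3
    · exact sub_eq_zero.1 h3
    · have h4 := congrArg norm (sub_eq_zero.1 h3)
      rw [norm_mul, norm_one] at h4
      have := mem_ball_zero_iff.1 hu.1
      have := mem_ball_zero_iff.1 hv.1
      nlinarith [norm_nonneg u, norm_nonneg v]
  · set τ : ℂ := -(t + b) / c with hτ
    have hτim : τ.im < 0 := by
      have ht' : 0 < t.im := ht
      rw [hτ, div_ofReal_im]
      simp only [neg_im, add_im, ofReal_im, add_zero]
      exact div_neg_of_neg_of_pos (by linarith) hc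
    obtain ⟨s, hs⟩ := IsAlgClosed.exists_pow_nat_eq (τ ^ 2 - 4) (n := 2) two_pos
    -- The two roots of `u + 1/u = τ` have product one, so one lies in the closed disk; `Im τ < 0`
    -- then keeps it off the circle.
    have hroot : ∃ u : ℂ, ‖u‖ ≤ 1 ∧ u ≠ 0 ∧ u⁻¹ + u = τ := by
      have hprod : (τ + s) / 2 * ((τ - s) / 2) = 1 := by linear_combination -hs / 4
      have h1 : (τ + s) / 2 ≠ 0 := left_ne_zero_of_mul_eq_one hprod
      have h2 : (τ - s) / 2 ≠ 0 := right_ne_zero_of_mul_eq_one hprod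
      rcases le_or_gt ‖(τ + s) / 2‖ 1 with h | h
      · refine ⟨_, h, h1, ?_⟩
        rw [inv_eq_of_mul_eq_one_right hprod]
        ring
      · refine ⟨(τ - s) / 2, ?_, h2, ?_⟩
        · have := congrArg norm hprod
          rw [norm_mul, norm_one] at this
          nlinarith [norm_nonneg ((τ - s) / 2)]
        · rw [inv_eq_of_mul_eq_one_left hprod]
          ring
    obtain ⟨u, hu1, hu0, hu⟩ := hroot
    have him : u.im * (1 - (normSq u)⁻¹) < 0 := by rw [← im_inv_add_self, hu]; exact hτim
    have hn : normSq u ≤ 1 := by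
      rw [normSq_eq_norm_sq]
      nlinarith [norm_nonneg u]
    have hn1 : 1 ≤ (normSq u)⁻¹ := (one_le_inv₀ (normSq_pos.2 hu0)).2 hn
    have hlt : ‖u‖ < 1 := by
      refine hu1.lt_of_ne fun h ↦ ?_
      rw [normSq_eq_norm_sq, h] at him
      norm_num at him
    refine ⟨u, ⟨mem_ball_zero_iff.2 hlt, ?_⟩, ?_⟩
    · change 0 < u.im
      by_contra! h
      nlinarith
    · simp only [hu, hτ]
      field_simp
      ring

namespace IsSymmetricRiemannMap

variable {Ω : Set ℂ} {Φ : ℂ → ℂ} {c : ℝ} (H : IsSymmetricRiemannMap Ω Φ c)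
include H

lemma mem_nhds : Ω ∈ 𝓝 0 := H.isOpen.mem_nhds H.zero_mem

lemma im_neg {ζ : ℂ} (hζ : ζ ∈ Ω) (h : ζ.im < 0) : (Φ ζ).im < 0 := by
  have := H.im_pos _ (H.conj_mem ζ hζ) (by simpa using h)
  rw [H.map_conj ζ hζ] at this
  simpa using this

lemma im_eq_zero {ζ : ℂ} (hζ : ζ ∈ Ω) (h : (Φ ζ).im = 0) : ζ.im = 0 := by
  rcases lt_trichotomy ζ.im 0 with h1 | h1 | h1
  · exact absurd h (H.im_neg hζ h1).ne
  · exact h1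
  · exact absurd h (H.im_pos ζ hζ h1).ne'

lemma im_pos_of_im_pos {ζ : ℂ} (hζ : ζ ∈ Ω) (h : 0 < (Φ ζ).im) : 0 < ζ.im := by
  by_contra! h1
  rcases h1.lt_or_eq with h1 | h1
  · exact lt_asymm h (H.im_neg hζ h1)
  · have h2 := H.map_conj ζ hζ
    rw [conj_eq_iff_im.2 h1] at h2
    have := conj_eq_iff_im.1 h2.symm
    linarith

lemma conformalOnto_upper : ConformalOnto Φ (Ω ∩ upperHalfPlaneSet)
    (ball 0 1 ∩ upperHalfPlaneSet) := by
  refine ⟨H.conformal.1.mono inter_subset_left, fun ζ hζ ↦ ⟨H.conformal.2.mapsTo hζ.1,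
    H.im_pos ζ hζ.1 hζ.2⟩, H.conformal.2.injOn.mono inter_subset_left, fun u hu ↦ ?_⟩
  obtain ⟨ζ, hζ, rfl⟩ := H.conformal.2.surjOn hu.1
  exact ⟨ζ, ⟨hζ, H.im_pos_of_im_pos hζ hu.2⟩, rfl⟩

lemma differentiableOn_dslope : DifferentiableOn ℂ (dslope Φ 0) Ω :=
  (Complex.differentiableOn_dslope H.mem_nhds).2 H.conformal.1

lemma map_ne_zero {ζ : ℂ} (hζ : ζ ∈ Ω) (hne : ζ ≠ 0) : Φ ζ ≠ 0 := fun h ↦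
  hne (H.conformal.2.injOn hζ H.zero_mem (by rw [h, H.map_zero]))

lemma dslope_ne_zero {ζ : ℂ} (hζ : ζ ∈ Ω) : dslope Φ 0 ζ ≠ 0 := by
  rcases eq_or_ne ζ 0 with rfl | hne
  · rw [dslope_same, H.deriv_zero]
    exact_mod_cast H.pos.ne'
  · rw [dslope_of_ne _ hne, slope_def_field, H.map_zero, sub_zero, sub_zero]
    exact div_ne_zero (H.map_ne_zero hζ hne) hne

/-- The function `T` with `T ζ = b - 1 / ζ + c / Φ ζ + c * Φ ζ` away from the origin, where the
real number `b` makes it vanish at the origin. -/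
lemma exists_deviation : ∃ (T : ℂ → ℂ) (b : ℝ), DifferentiableOn ℂ T Ω ∧ T 0 = 0 ∧
    (∀ ζ ∈ Ω, T (conj ζ) = conj (T ζ)) ∧
    ∀ ζ ∈ Ω, ζ ≠ 0 → T ζ = b - ζ⁻¹ + c * ((Φ ζ)⁻¹ + Φ ζ) := by
  set D := dslope Φ 0 with hD
  -- Since `Φ ζ = ζ * D ζ` and `D 0 = c`, this is `1/ζ - c/Φ ζ` with the pole removed. Its value at
  -- `0` is real by symmetry and provides `b`.
  set P : ℂ → ℂ := fun ζ ↦ dslope D 0 ζ / D ζ with hP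
  have hDc : ∀ ζ ∈ Ω, D (conj ζ) = conj (D ζ) := fun ζ hζ ↦ dslope_conj H.mem_nhds H.map_conj hζ
  have hPc : ∀ ζ ∈ Ω, P (conj ζ) = conj (P ζ) := by
    intro ζ hζ
    simp only [hP, map_div₀, hDc ζ hζ, dslope_conj H.mem_nhds hDc hζ]
  have hP0 : conj (P 0) = P 0 := by simpa using (hPc 0 H.zero_mem).symm
  obtain ⟨b, hb⟩ := conj_eq_iff_real.1 hP0
  have hPd : DifferentiableOn ℂ P Ω :=
    ((Complex.differentiableOn_dslope H.mem_nhds).2 H.differentiableOn_dslope).div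
      H.differentiableOn_dslope fun ζ hζ ↦ H.dslope_ne_zero hζ
  refine ⟨fun ζ ↦ P 0 - P ζ + c * Φ ζ, b, ?_, ?_, ?_, ?_⟩
  · exact ((differentiableOn_const _).sub hPd).add (H.conformal.1.const_mul _)
  · simp [H.map_zero]
  · intro ζ hζ
    simp [hPc ζ hζ, hP0, H.map_conj ζ hζ]
  · intro ζ hζ hne
    have hΦ := H.map_ne_zero hζ hne
    have : P ζ = ζ⁻¹ - c * (Φ ζ)⁻¹ := by
      simp only [hP, hD]
      rw [dslope_of_ne _ hne, dslope_of_ne _ hne, slope_def_field, slope_def_field, dslope_same,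
        H.deriv_zero, dslope_of_ne _ hne, slope_def_field, H.map_zero, sub_zero, sub_zero]
      field_simp
    change P 0 - P ζ + c * Φ ζ = _
    rw [this, hb]
    ring

/-- The deviation is typically real. -/
lemma im_deviation_nonneg {T : ℂ → ℂ} {b : ℝ} (hT : DifferentiableOn ℂ T Ω)
    (hTc : ∀ ζ ∈ Ω, T (conj ζ) = conj (T ζ))
    (hTe : ∀ ζ ∈ Ω, ζ ≠ 0 → T ζ = b - ζ⁻¹ + c * ((Φ ζ)⁻¹ + Φ ζ)) {ζ : ℂ} (hζ : ζ ∈ Ω)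
    (him : 0 < ζ.im) : 0 ≤ (T ζ).im := by
  obtain ⟨Ψ, hΨ, hinv⟩ := H.conformal.symm H.isOpen
  set N : ℂ → ℂ := T ∘ Ψ with hN
  have hNd : DifferentiableOn ℂ N (ball 0 1) := hT.comp hΨ.1 hΨ.2.mapsTo
  set u := Φ ζ with hu
  have hu1 : ‖u‖ < 1 := mem_ball_zero_iff.1 (H.conformal.2.mapsTo hζ)
  have huim : 0 < u.im := H.im_pos ζ hζ him
  have hTN : T ζ = N u := by rw [hN, Function.comp_apply, hu, hinv.1 hζ]
  rw [hTN]
  have hc := H.pos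
  -- Maximum principle for `exp (I * N)` on the half-disk of radius `s`. On the arc `-Im (1/Ψ) ≥ 0`,
  -- while the Joukowski term loses at most `c (s⁻² - 1)`, which vanishes as `s → 1`. Stopping short
  -- of radius one avoids any boundary regularity of `Ω`.
  have key : ∀ s, ‖u‖ < s → s < 1 → -(c * ((s ^ 2)⁻¹ - 1)) ≤ (N u).im := by
    intro s hus hs1
    have hs : 0 < s := (norm_nonneg _).trans_lt hus
    have hinv1 : 1 ≤ (s ^ 2)⁻¹ := (one_le_inv₀ (by positivity)).2 (by nlinarith)
    set X : Set ℂ := ball 0 s ∩ upperHalfPlaneSet with hX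
    have hXo : IsOpen X := isOpen_ball.inter isOpen_upperHalfPlaneSet
    have hXc : closure X ⊆ closedBall 0 s ∩ {w | 0 ≤ w.im} := by
      refine closure_minimal (fun w hw ↦ ⟨ball_subset_closedBall hw.1, le_of_lt (b := w.im) hw.2⟩) ?_
      exact isClosed_closedBall.inter (isClosed_le continuous_const continuous_im)
    have hexp : DifferentiableOn ℂ (fun w ↦ exp (I * N w)) (ball 0 1) := by fun_prop
    have hdc : DiffContOnCl ℂ (fun w ↦ exp (I * N w)) X := by
      refine DifferentiableOn.diffContOnCl (hexp.mono fun w hw ↦ ?_)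
      exact closedBall_subset_ball hs1 (hXc hw).1
    have hle := norm_le_of_forall_mem_frontier_norm_le (isBounded_ball.subset inter_subset_left)
      hdc (C := Real.exp (c * ((s ^ 2)⁻¹ - 1))) ?_
      (subset_closure (show u ∈ X from ⟨mem_ball_zero_iff.2 hus, huim⟩))
    · rw [norm_exp, Real.exp_le_exp] at hle
      simp at hle
      linarith
    · intro w hw
      rw [hXo.frontier_eq] at hw
      obtain ⟨hwcl, hwX⟩ := hw
      obtain ⟨hws, hwim⟩ := hXc hwcl
      rw [mem_closedBall_zero_iff] at hws
      have hwim' : 0 ≤ w.im := hwim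
      have hw1 : w ∈ ball (0 : ℂ) 1 := mem_ball_zero_iff.2 (hws.trans_lt hs1)
      have hΦΨ : Φ (Ψ w) = w := hinv.2 hw1
      have hΨw : Ψ w ∈ Ω := hΨ.2.mapsTo hw1
      rw [norm_exp, Real.exp_le_exp]
      suffices -(N w).im ≤ c * ((s ^ 2)⁻¹ - 1) by simpa using this
      rcases hwim'.lt_or_eq with hpos | hzero
      · have hsw : ‖w‖ = s := by
          refine le_antisymm hws ?_
          by_contra! h
          exact hwX ⟨mem_ball_zero_iff.2 h, hpos⟩
        have hΨim : 0 < (Ψ w).im := H.im_pos_of_im_pos hΨw (by rwa [hΦΨ])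
        have hΨ0 : Ψ w ≠ 0 := by
          intro h
          rw [h] at hΨim
          exact lt_irrefl _ hΨim
        have hval : (N w).im = -(Ψ w)⁻¹.im + c * (w.im * (1 - (s ^ 2)⁻¹)) := by
          rw [hN, Function.comp_apply, hTe _ hΨw hΨ0, hΦΨ, add_im, im_ofReal_mul,
            im_inv_add_self, normSq_eq_norm_sq, hsw, sub_im, ofReal_im, zero_sub]
        have hneg : (Ψ w)⁻¹.im ≤ 0 := by
          rw [inv_im]
          exact div_nonpos_of_nonpos_of_nonneg (by linarith) (normSq_nonneg _)
        have hwim1 : w.im ≤ 1 := (le_abs_self _).trans ((abs_im_le_norm w).trans (by linarith))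
        rw [hval]
        nlinarith [mul_nonneg hc.le (mul_nonneg (sub_nonneg.2 hinv1) (sub_nonneg.2 hwim1))]
      -- On the diameter `Ψ w` is real, hence so is `N w` by the symmetry of `T`.
      · have h1 : (Ψ w).im = 0 := H.im_eq_zero hΨw (by rw [hΦΨ, ← hzero])
        have h2 := hTc _ hΨw
        rw [conj_eq_iff_im.2 h1] at h2
        have h3 : (N w).im = 0 := conj_eq_iff_im.1 h2.symm
        rw [h3, neg_zero]
        exact mul_nonneg hc.le (by linarith)
  have hcont : Tendsto (fun s : ℝ ↦ -(c * ((s ^ 2)⁻¹ - 1))) (𝓝[<] 1) (𝓝 0) := by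
    have : ContinuousAt (fun s : ℝ ↦ -(c * ((s ^ 2)⁻¹ - 1))) 1 := by
      fun_prop (disch := norm_num)
    have := this.tendsto.mono_left (nhdsWithin_le_nhds (s := Iio 1))
    simpa using this
  refine le_of_tendsto hcont ?_
  filter_upwards [Ioo_mem_nhdsLT hu1] with s hs using key s hs.1 hs.2

end IsSymmetricRiemannMap

/-! ### The inverted and reflected domain -/

lemma ne_zero_of_mem_upperHalfPlaneSet {z : ℂ} (hz : z ∈ upperHalfPlaneSet) : z ≠ 0 := by
  rintro rfl
  exact lt_irrefl (0 : ℝ) hz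

lemma neg_inv_neg_inv (z : ℂ) : -(-z⁻¹)⁻¹ = z := by rw [inv_neg, inv_inv, neg_neg]

lemma neg_inv_im_pos_iff {z : ℂ} : 0 < (-z⁻¹).im ↔ 0 < z.im := by
  rcases eq_or_ne z 0 with rfl | hz
  · simp
  · have : (-z⁻¹).im = z.im / normSq z := by rw [neg_im, inv_im, neg_div, neg_neg]
    rw [this, div_pos_iff_of_pos_right (normSq_pos.2 hz)]

/-- The image of `ℍ \ A` under `z ↦ -1 / z`. -/
def invertedCompl (A : Set ℂ) : Set ℂ := {ζ | -ζ⁻¹ ∈ upperHalfPlaneSet \ A}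

/-- The domain obtained from the image of `ℍ \ A` under `z ↦ -1 / z` by reflection, and by adding
a disk about the origin. -/
def invertedDomain (A : Set ℂ) (r : ℝ) : Set ℂ :=
  (invertedCompl A ∪ ball 0 r) ∪ conj ⁻¹' invertedCompl A

section Domain

variable {A : Set ℂ} {r : ℝ}

lemma im_pos_of_mem_invertedCompl {ζ : ℂ} (h : ζ ∈ invertedCompl A) : 0 < ζ.im :=
  neg_inv_im_pos_iff.1 h.1

lemma neg_inv_mem_invertedCompl {z : ℂ} (h : z ∈ upperHalfPlaneSet \ A) :
    -z⁻¹ ∈ invertedCompl A := by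
  change -(-z⁻¹)⁻¹ ∈ upperHalfPlaneSet \ A
  rwa [neg_inv_neg_inv]

lemma continuousOn_neg_inv : ContinuousOn (fun z : ℂ ↦ -z⁻¹) upperHalfPlaneSet := by
  exact (continuousOn_inv₀.mono fun _ hz ↦ ne_zero_of_mem_upperHalfPlaneSet hz).neg

lemma invertedCompl_subset : invertedCompl A ⊆ upperHalfPlaneSet :=
  fun _ h ↦ im_pos_of_mem_invertedCompl h

lemma isOpen_invertedCompl (hA : IsHull A) : IsOpen (invertedCompl A) := by
  have h := continuousOn_neg_inv.isOpen_inter_preimage isOpen_upperHalfPlaneSet hA.isOpen_compl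
  rwa [inter_eq_right.2 (show (fun z : ℂ ↦ -z⁻¹) ⁻¹' (upperHalfPlaneSet \ A) ⊆ upperHalfPlaneSet
    from invertedCompl_subset)] at h

lemma conformalOnto_neg_inv : ConformalOnto (fun z : ℂ ↦ -z⁻¹) (upperHalfPlaneSet \ A)
    (invertedCompl A) := by
  refine ⟨fun z hz ↦ ?_, InvOn.bijOn (f' := fun z : ℂ ↦ -z⁻¹)
    ⟨fun z _ ↦ neg_inv_neg_inv z, fun z _ ↦ neg_inv_neg_inv z⟩
    (fun z hz ↦ neg_inv_mem_invertedCompl hz) (fun z hz ↦ hz)⟩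
  have := ne_zero_of_mem_upperHalfPlaneSet hz.1
  exact DifferentiableAt.differentiableWithinAt (by fun_prop (disch := assumption))

lemma isPreconnected_invertedCompl (hA : IsHull A) : IsPreconnected (invertedCompl A) := by
  rw [← (conformalOnto_neg_inv (A := A)).2.image_eq]
  exact hA.simplyConnected_compl.isPathConnected.isConnected.isPreconnected.image _
    (continuousOn_neg_inv.mono sdiff_subset)

lemma ball_inter_subset_invertedCompl (hAr : ∀ a ∈ A, ‖a‖ * r < 1) :
    ball 0 r ∩ upperHalfPlaneSet ⊆ invertedCompl A := by
  rintro ζ ⟨hζ, him⟩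
  refine ⟨neg_inv_im_pos_iff.2 him, fun h ↦ ?_⟩
  have h1 := hAr _ h
  have hpos : 0 < ‖ζ‖ := norm_pos_iff.2 (ne_zero_of_mem_upperHalfPlaneSet him)
  rw [norm_neg, norm_inv, inv_mul_lt_iff₀ hpos, mul_one] at h1
  exact lt_asymm h1 (mem_ball_zero_iff.1 hζ)

lemma isOpen_invertedDomain (hA : IsHull A) : IsOpen (invertedDomain A r) :=
  ((isOpen_invertedCompl hA).union isOpen_ball).union
    ((isOpen_invertedCompl hA).preimage continuous_conj)

lemma ball_subset_invertedDomain : ball 0 r ⊆ invertedDomain A r :=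
  fun _ h ↦ Or.inl (Or.inr h)

lemma invertedDomain_conj_mem {ζ : ℂ} (h : ζ ∈ invertedDomain A r) :
    conj ζ ∈ invertedDomain A r := by
  rcases h with (h | h) | h
  · exact Or.inr (by simpa using h)
  · exact Or.inl (Or.inr (ball_conj_mem h))
  · exact Or.inl (Or.inl h)

lemma invertedDomain_inter (hAr : ∀ a ∈ A, ‖a‖ * r < 1) :
    invertedDomain A r ∩ upperHalfPlaneSet = invertedCompl A := by
  refine Subset.antisymm ?_ fun ζ h ↦ ⟨Or.inl (Or.inl h), im_pos_of_mem_invertedCompl h⟩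
  rintro ζ ⟨(h | h) | h, him⟩
  · exact h
  · exact ball_inter_subset_invertedCompl hAr ⟨h, him⟩
  · have h1 := im_pos_of_mem_invertedCompl (A := A) h
    have him' : 0 < ζ.im := him
    rw [conj_im] at h1
    linarith

lemma invertedCompl_inter_ball (hAr : ∀ a ∈ A, ‖a‖ * r < 1) :
    invertedCompl A ∩ ball 0 r = ball 0 r ∩ upperHalfPlaneSet :=
  Subset.antisymm (fun _ h ↦ ⟨h.2, im_pos_of_mem_invertedCompl h.1⟩)
    fun _ h ↦ ⟨ball_inter_subset_invertedCompl hAr h, h.1⟩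

lemma union_inter_conj_preimage (hAr : ∀ a ∈ A, ‖a‖ * r < 1) :
    (invertedCompl A ∪ ball 0 r) ∩ conj ⁻¹' invertedCompl A = ball 0 r ∩ {w | w.im < 0} := by
  refine Subset.antisymm ?_ fun ζ h ↦ ⟨Or.inr h.1, ball_inter_subset_invertedCompl hAr
    ⟨ball_conj_mem h.1, ?_⟩⟩
  · rintro ζ ⟨h1, h2⟩
    have h3 : ζ.im < 0 := by simpa using im_pos_of_mem_invertedCompl (A := A) h2
    rcases h1 with h1 | h1
    · exact absurd h3 (im_pos_of_mem_invertedCompl h1).not_gt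
    · exact ⟨h1, h3⟩
  · have : ζ.im < 0 := h.2
    change 0 < (conj ζ).im
    rw [conj_im]
    linarith

lemma isPreconnected_ball_inter_upper : IsPreconnected (ball (0 : ℂ) r ∩ upperHalfPlaneSet) :=
  ((convex_ball 0 r).inter (convex_halfSpace_im_gt 0)).isPreconnected

lemma isPreconnected_ball_inter_lower : IsPreconnected (ball (0 : ℂ) r ∩ {w | w.im < 0}) :=
  ((convex_ball 0 r).inter (convex_halfSpace_im_lt 0)).isPreconnected

/-- The pieces overlap in half-disks, which are convex, so square roots glue twice; simple
connectedness of the union is never needed. -/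
lemma hasSqrtBranches_invertedDomain (hA : IsHull A) (hAr : ∀ a ∈ A, ‖a‖ * r < 1) :
    HasSqrtBranches (invertedDomain A r) := by
  have hV : HasSqrtBranches (invertedCompl A) :=
    (HasSqrtBranches.of_isSimplyConnected hA.isOpen_compl hA.simplyConnected_compl).of_involution
      (e := fun z ↦ -z⁻¹) (continuousOn_neg_inv.mono sdiff_subset)
      (continuousOn_neg_inv.mono invertedCompl_subset) (fun z hz ↦ neg_inv_mem_invertedCompl hz)
      (fun z hz ↦ hz) fun z _ ↦ neg_inv_neg_inv z
  have hW : HasSqrtBranches (conj ⁻¹' invertedCompl A) :=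
    hV.of_involution (e := conj) continuous_conj.continuousOn continuous_conj.continuousOn
      (fun z hz ↦ by simpa using hz) (fun z hz ↦ hz) fun z _ ↦ conj_conj z
  have hVo := isOpen_invertedCompl hA
  refine (hV.union hVo isOpen_ball (.of_ball 0 r) ?_).union (hVo.union isOpen_ball)
    (hVo.preimage continuous_conj) hW ?_
  · rw [invertedCompl_inter_ball hAr]
    exact isPreconnected_ball_inter_upper
  · rw [union_inter_conj_preimage hAr]
    exact isPreconnected_ball_inter_lower

lemma isPreconnected_invertedDomain (hA : IsHull A) (hr : 0 < r)
    (hAr : ∀ a ∈ A, ‖a‖ * r < 1) : IsPreconnected (invertedDomain A r) := by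
  have hV := isPreconnected_invertedCompl hA
  have hW : IsPreconnected (conj ⁻¹' invertedCompl A) := by
    have : conj ⁻¹' invertedCompl A = conj '' invertedCompl A :=
      (congrFun (image_eq_preimage_of_inverse conj_conj conj_conj) _).symm
    rw [this]
    exact hV.image _ continuous_conj.continuousOn
  have hn : ‖((r / 2 : ℝ) : ℂ) * I‖ < r := by
    rw [norm_mul, norm_I, norm_real, Real.norm_of_nonneg (by positivity)]
    linarith
  refine (hV.union' ?_ (convex_ball 0 r).isPreconnected).union' ?_ hW
  · rw [invertedCompl_inter_ball hAr]
    exact ⟨(r / 2 : ℝ) * I, mem_ball_zero_iff.2 hn, by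
      change 0 < (((r / 2 : ℝ) : ℂ) * I).im
      simpa using hr⟩
  · rw [union_inter_conj_preimage hAr]
    exact ⟨-((r / 2 : ℝ) * I), mem_ball_zero_iff.2 (by rwa [norm_neg]), by simpa using hr⟩

end Domain

/-! ### The hydrodynamically normalized map -/

/-- For a nonempty hull `A` there is a conformal map of `ℍ \ A` onto `ℍ` of the form
`z ↦ z - T (-1 / z)` where `T` is typically real near the origin. -/
lemma IsHull.exists_conformalOnto {A : Set ℂ} (hA : IsHull A) (hne : A.Nonempty) {r : ℝ}
    (hr : 0 < r) (hAr : ∀ a ∈ A, ‖a‖ * r < 1) :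
    ∃ (T : ℂ → ℂ) (h : ℝ), DifferentiableOn ℂ T (ball 0 r) ∧ T 0 = 0 ∧ deriv T 0 = h ∧ 0 < h ∧
      (∀ ζ ∈ ball (0 : ℂ) r, 0 ≤ ζ.im * (T ζ).im) ∧
      ConformalOnto (fun z ↦ z - T (-z⁻¹)) (upperHalfPlaneSet \ A) upperHalfPlaneSet := by
  have hΩ : IsOpen (invertedDomain A r) := isOpen_invertedDomain hA
  have hpc := isPreconnected_invertedDomain hA hr hAr
  have h0 : (0 : ℂ) ∈ invertedDomain A r := ball_subset_invertedDomain (mem_ball_self hr)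
  have hnu : invertedDomain A r ≠ univ := by
    obtain ⟨a, ha⟩ := hne
    intro h
    have h1 : -a⁻¹ ∈ invertedDomain A r ∩ upperHalfPlaneSet :=
      ⟨h ▸ mem_univ _, neg_inv_im_pos_iff.2 (hA.subset ha)⟩
    rw [invertedDomain_inter hAr] at h1
    have h2 : -(-a⁻¹)⁻¹ ∈ upperHalfPlaneSet \ A := h1
    rw [neg_inv_neg_inv] at h2
    exact h2.2 ha
  obtain ⟨Φ, c, H⟩ := exists_isSymmetricRiemannMap hΩ h0 (fun ζ hζ ↦ invertedDomain_conj_mem hζ)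
    (by rw [invertedDomain_inter hAr]; exact isPreconnected_invertedCompl hA)
    ((hasSqrtBranches_invertedDomain hA hAr).exists_conformalOnto hΩ hpc hnu h0)
  obtain ⟨T, b, hT, hT0, hTc, hTe⟩ := H.exists_deviation
  have hTb : DifferentiableOn ℂ T (ball 0 r) := hT.mono ball_subset_invertedDomain
  obtain ⟨h, hh⟩ : ∃ h : ℝ, deriv T 0 = h := by
    have := dslope_conj H.mem_nhds hTc h0
    rw [map_zero, dslope_same] at this
    exact conj_eq_iff_real.1 this.symm
  have hpos : ∀ ζ ∈ ball (0 : ℂ) r, 0 ≤ ζ.im * (T ζ).im := by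
    intro ζ hζ
    have hζΩ := ball_subset_invertedDomain (A := A) hζ
    rcases lt_trichotomy ζ.im 0 with him | him | him
    · have h1 := H.im_deviation_nonneg hT hTc hTe (H.conj_mem ζ hζΩ) (by simpa using him)
      rw [hTc ζ hζΩ, conj_im] at h1
      nlinarith
    · rw [him, zero_mul]
    · exact mul_nonneg him.le (H.im_deviation_nonneg hT hTc hTe hζΩ him)
  have hg : ConformalOnto (fun z ↦ z - T (-z⁻¹)) (upperHalfPlaneSet \ A) upperHalfPlaneSet := by
    have hΦ := H.conformalOnto_upper
    rw [invertedDomain_inter hAr] at hΦ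
    refine ((conformalOnto_joukowski H.pos b).comp
      (hΦ.comp conformalOnto_neg_inv)).congr fun z hz ↦ ?_
    have hζ : -z⁻¹ ∈ invertedDomain A r := Or.inl (Or.inl (neg_inv_mem_invertedCompl hz))
    have hz0 := ne_zero_of_mem_upperHalfPlaneSet hz.1
    simp only [Function.comp_apply]
    rw [hTe _ hζ (neg_ne_zero.2 (inv_ne_zero hz0)), inv_neg, inv_inv]
    ring
  obtain ⟨hnn, hbound⟩ := norm_sub_le_of_typicallyReal hr hTb hT0 hpos hh
  refine ⟨T, h, hTb, hT0, hh, hnn.lt_of_ne fun hzero ↦ ?_, hpos, hg⟩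
  -- If `h = 0`, the bound makes `T` vanish near `0`, hence on the whole connected domain. The map
  -- would then be the identity on `ℍ \ A` and miss the points of `A`.
  have hev : T =ᶠ[𝓝 0] 0 := by
    filter_upwards [ball_mem_nhds (0 : ℂ) (half_pos hr)] with ζ hζ
    simpa [← hzero] using hbound ζ (mem_ball_zero_iff.1 hζ).le
  have hT' := (hT.analyticOnNhd hΩ).eqOn_zero_of_preconnected_of_eventuallyEq_zero hpc h0 hev
  obtain ⟨a, ha⟩ := hne
  obtain ⟨z, hz, hza⟩ := hg.2.surjOn (hA.subset ha)
  have h1 : T (-z⁻¹) = 0 := hT' (Or.inl (Or.inl (neg_inv_mem_invertedCompl hz)))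
  simp only [h1, sub_zero] at hza
  exact hz.2 (hza ▸ ha)

/-! ### Behaviour at infinity -/

/-- Needed for uniqueness of limits at infinity; high points of the imaginary axis are the
witnesses. -/
lemma atInfty_neBot {A : Set ℂ} (hA : Bornology.IsBounded A) : (atInfty A).NeBot := by
  rw [atInfty, inf_principal_neBot_iff]
  intro s hs
  have hb : Bornology.IsBounded (sᶜ ∪ A) := (Bornology.isBounded_def.2 (by simpa using hs)).union hA
  obtain ⟨R, hR⟩ := hb.subset_ball 0
  have hz : ((|R| + 1 : ℝ) : ℂ) * I ∉ sᶜ ∪ A := by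
    intro h
    have := mem_ball_zero_iff.1 (hR h)
    rw [norm_mul, norm_I, norm_real, Real.norm_of_nonneg (by positivity)] at this
    linarith [le_abs_self R]
  rw [mem_union, not_or, notMem_compl_iff] at hz
  refine ⟨_, hz.1, ?_, hz.2⟩
  change 0 < (((|R| + 1 : ℝ) : ℂ) * I).im
  rw [im_ofReal_mul, I_im]
  positivity

lemma eventually_atInfty_mem (A : Set ℂ) : ∀ᶠ z in atInfty A, z ∈ upperHalfPlaneSet \ A :=
  mem_inf_of_right (mem_principal_self _)

lemma tendsto_inv_atInfty (A : Set ℂ) : Tendsto (fun z : ℂ ↦ z⁻¹) (atInfty A) (𝓝 0) :=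
  tendsto_inv₀_cobounded.mono_left inf_le_left

lemma isHalfPlaneCapacity_of_hasDerivAt {A : Set ℂ} {T : ℂ → ℂ} {h : ℝ} (hT0 : T 0 = 0)
    (hT : HasDerivAt T h 0)
    (hg : ConformalOnto (fun z ↦ z - T (-z⁻¹)) (upperHalfPlaneSet \ A) upperHalfPlaneSet) :
    IsHydrodynamicMap A (fun z ↦ z - T (-z⁻¹)) ∧
      Tendsto (fun z ↦ z * ((z - T (-z⁻¹)) - z)) (atInfty A) (𝓝 (h : ℂ)) := by
  have hlim : Tendsto (fun z : ℂ ↦ -z⁻¹) (atInfty A) (𝓝 0) := by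
    simpa using (tendsto_inv_atInfty A).neg
  refine ⟨⟨hg, ?_⟩, ?_⟩
  · have h1 : (fun ζ ↦ T ζ - T 0) =O[𝓝 0] fun ζ ↦ ζ - 0 := hT.isBigO_sub
    have h2 := (h1.comp_tendsto hlim).neg_left
    simp only [Function.comp_def, hT0, sub_zero] at h2
    refine (h2.congr_left fun z ↦ by ring).trans ?_
    exact (isBigO_refl _ _).neg_left
  · rw [hasDerivAt_iff_tendsto_slope] at hT
    have hlim' : Tendsto (fun z : ℂ ↦ -z⁻¹) (atInfty A) (𝓝[≠] 0) := by
      refine tendsto_nhdsWithin_iff.2 ⟨hlim, ?_⟩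
      filter_upwards [eventually_atInfty_mem A] with z hz
      exact neg_ne_zero.2 (inv_ne_zero (ne_zero_of_mem_upperHalfPlaneSet hz.1))
    refine (hT.comp hlim').congr' ?_
    filter_upwards [eventually_atInfty_mem A] with z hz
    have := ne_zero_of_mem_upperHalfPlaneSet hz.1
    rw [Function.comp_apply, slope_def_field, hT0]
    field_simp
    ring

namespace IsHydrodynamicMap

variable {A : Set ℂ} {g g' : ℂ → ℂ}

lemma tendsto_sub (hg : IsHydrodynamicMap A g) :
    Tendsto (fun z ↦ g z - z) (atInfty A) (𝓝 0) :=
  hg.2.trans_tendsto (tendsto_inv_atInfty A)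

lemma tendsto_cobounded (hg : IsHydrodynamicMap A g) :
    Tendsto g (atInfty A) (Bornology.cobounded ℂ) := by
  have h : Tendsto (fun z : ℂ ↦ ‖z‖) (atInfty A) atTop :=
    tendsto_norm_cobounded_atTop.mono_left inf_le_left
  rw [← tendsto_norm_atTop_iff_cobounded]
  have h1 := h.atTop_add hg.tendsto_sub.norm.neg
  refine tendsto_atTop_mono (fun z ↦ ?_) h1
  have := norm_sub_norm_le z (z - g z)
  rw [sub_sub_cancel, norm_sub_rev z] at this
  linarith

lemma tendsto_cayley (hg : IsHydrodynamicMap A g) {q : ℂ} (hq : 0 < q.im) :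
    Tendsto (fun z ↦ cayley q (g z)) (atInfty A) (𝓝 1) := by
  have h1 : Tendsto (fun z ↦ g z - conj q) (atInfty A) (Bornology.cobounded ℂ) :=
    (tendsto_sub_const_cobounded (conj q)).comp hg.tendsto_cobounded
  have h2 := ((tendsto_inv₀_cobounded.comp h1).const_mul (conj q - q)).const_add 1
  rw [mul_zero, add_zero] at h2
  refine h2.congr' ?_
  filter_upwards [eventually_atInfty_mem A] with z hz
  have := cayley_den_ne_zero hq (hg.1.2.mapsTo hz)
  rw [cayley, Function.comp_apply]
  field_simp
  ring

/-- The hydrodynamically normalized map is unique. -/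
lemma eqOn (hA : IsHull A) (hg : IsHydrodynamicMap A g) (hg' : IsHydrodynamicMap A g') :
    EqOn g' g (upperHalfPlaneSet \ A) := by
  have := atInfty_neBot hA.bounded
  have hU := hA.isOpen_compl
  obtain ⟨p, hp, hpI⟩ := hg'.1.2.surjOn (show I ∈ upperHalfPlaneSet by
    change 0 < I.im
    simp)
  have hq : 0 < (g p).im := hg.1.2.mapsTo hp
  have hI : 0 < I.im := by simp
  set a := (g p).re with ha
  set b := (g p).im with hb
  have hb0 : (b : ℂ) ≠ 0 := by exact_mod_cast hq.ne'
  have hf := (conformalOnto_cayley hq).comp hg.1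
  have hf' := (conformalOnto_cayley hI).comp hg'.1
  obtain ⟨k, hk, hinv⟩ := hf.symm hU
  have hk0 : k 0 = p := by
    rw [← hinv.1 hp]
    simp
  -- Both Cayley-transformed maps send `p` to `0`, so they differ by a rotation `κ`. Both tend to
  -- `1` at infinity, which forces `κ = 1`.
  have hrot := ((hf'.comp hk).rotation (by simp [hk0, hpI])).2
  set κ := deriv ((cayley I ∘ g') ∘ k) 0
  have hrot' : ∀ z ∈ upperHalfPlaneSet \ A, cayley I (g' z) = κ * cayley (g p) (g z) := by
    intro z hz
    have := hrot _ (hf.2.mapsTo hz)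
    rwa [Function.comp_apply, hinv.1 hz] at this
  have hκ : κ = 1 := by
    have h1 := (hg.tendsto_cayley hq).const_mul κ
    rw [mul_one] at h1
    refine tendsto_nhds_unique (h1.congr' ?_) (hg'.tendsto_cayley hI)
    filter_upwards [eventually_atInfty_mem A] with z hz using (hrot' z hz).symm
  have haff : ∀ z ∈ upperHalfPlaneSet \ A, b * g' z = g z - a := by
    intro z hz
    have hgz : 0 < (g z).im := hg.1.2.mapsTo hz
    have hm : (g z - a) / b ∈ upperHalfPlaneSet := by
      change 0 < ((g z - a) / b).im
      rw [div_ofReal_im, sub_im, ofReal_im, sub_zero]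
      exact div_pos hgz hq
    have h1 : cayley I (g' z) = cayley I ((g z - a) / b) := by
      rw [hrot' z hz, hκ, one_mul, cayley, cayley, conj_I]
      have hqe : g p = a + b * I := (re_add_im (g p)).symm
      have hce : conj (g p) = a - b * I := by rw [hqe]; simp; ring
      have e1 : g z - g p = b * ((g z - a) / b - I) := by rw [hqe]; field_simp; ring
      have e2 : g z - conj (g p) = b * ((g z - a) / b - -I) := by rw [hce]; field_simp; ring
      rw [e1, e2, mul_div_mul_left _ _ hb0]
    rw [(conformalOnto_cayley hI).2.injOn (hg'.1.2.mapsTo hz) hm h1]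
    field_simp
  -- Equality of the two Cayley transforms gives `g = b g' + a`; the normalization of both maps then
  -- forces `b = 1` and `a = 0`.
  have hlin : Tendsto (fun z : ℂ ↦ (b - 1) * z + a) (atInfty A) (𝓝 0) := by
    have h1 := hg.tendsto_sub.sub (hg'.tendsto_sub.const_mul (b : ℂ))
    rw [mul_zero, sub_zero] at h1
    refine h1.congr' ?_
    filter_upwards [eventually_atInfty_mem A] with z hz
    linear_combination -haff z hz
  have hb1 : (b : ℂ) - 1 = 0 := by
    have h1 := (hlin.mul (tendsto_inv_atInfty A)).sub ((tendsto_inv_atInfty A).const_mul (a : ℂ))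
    simp only [mul_zero, sub_zero] at h1
    refine tendsto_nhds_unique (tendsto_const_nhds.congr' ?_) h1
    filter_upwards [eventually_atInfty_mem A] with z hz
    have := ne_zero_of_mem_upperHalfPlaneSet hz.1
    field_simp
    ring
  have ha0 : (a : ℂ) = 0 := by
    simp only [hb1, zero_mul, zero_add] at hlin
    exact tendsto_nhds_unique tendsto_const_nhds hlin
  intro z hz
  have := haff z hz
  rwa [sub_eq_zero.1 hb1, ha0, one_mul, sub_zero] at this

end IsHydrodynamicMap

lemma IsHalfPlaneCapacity.unique {A : Set ℂ} (hA : IsHull A) {h h' : ℝ}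
    (hh : IsHalfPlaneCapacity A h) (hh' : IsHalfPlaneCapacity A h') : h' = h := by
  have := atInfty_neBot hA.bounded
  obtain ⟨g, hg, hgl⟩ := hh
  obtain ⟨g', hg', hgl'⟩ := hh'
  have : (h' : ℂ) = h := by
    refine tendsto_nhds_unique hgl' (hgl.congr' ?_)
    filter_upwards [eventually_atInfty_mem A] with z hz
    rw [hg.eqOn hA hg' hz]
  exact_mod_cast this

lemma IsHalfPlaneCapacity.hcap_eq {A : Set ℂ} (hA : IsHull A) {h : ℝ}
    (hh : IsHalfPlaneCapacity A h) : hcap A = h := by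
  have hex : ∃ h : ℝ, IsHalfPlaneCapacity A h := ⟨h, hh⟩
  rw [hcap, dif_pos hex]
  exact hh.unique hA hex.choose_spec

/-! ### The conformal radius of the complement of a hull -/

lemma hasDerivAt_cayley_self {q : ℂ} (hq : 0 < q.im) :
    HasDerivAt (cayley q) (q - conj q)⁻¹ q := by
  have hne := cayley_den_ne_zero hq hq
  have := ((hasDerivAt_id q).sub_const q).div ((hasDerivAt_id q).sub_const (conj q)) hne
  convert! this using 1
  simp only [id]
  field_simp
  ring

/-- Following `g` by the Cayley transform at `g z`, whose derivative there has modulus `1 / (2 Im (g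
z))`, gives a Riemann map to the disk. -/
lemma isConformalRadius_iff_of_upperHalfPlane {D : Set ℂ} (hD : IsOpen D) {z : ℂ} (hz : z ∈ D)
    {g : ℂ → ℂ} (hg : ConformalOnto g D upperHalfPlaneSet) (ρ : ℝ) :
    IsConformalRadius D z ρ ↔ ρ = 2 * (g z).im / ‖deriv g z‖ := by
  have hq : 0 < (g z).im := hg.2.mapsTo hz
  rw [isConformalRadius_iff hD hz ((conformalOnto_cayley hq).comp hg) (by simp)]
  have hd := (hasDerivAt_cayley_self hq).comp z
    (hg.1.differentiableAt (hD.mem_nhds hz)).hasDerivAt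
  have hn : ‖g z - conj (g z)‖ = 2 * (g z).im := by
    rw [sub_conj, norm_mul, norm_I, mul_one, norm_real, Real.norm_of_nonneg (by positivity)]
  rw [hd.deriv, norm_mul, norm_inv, hn, mul_inv, inv_inv, div_eq_mul_inv]

lemma crad_eq_of_upperHalfPlane {D : Set ℂ} (hD : IsOpen D) {z : ℂ} (hz : z ∈ D)
    {g : ℂ → ℂ} (hg : ConformalOnto g D upperHalfPlaneSet) :
    IsConformalRadius D z (crad D z) ∧ crad D z = 2 * (g z).im / ‖deriv g z‖ := by
  have hex : ∃ ρ, IsConformalRadius D z ρ :=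
    ⟨_, (isConformalRadius_iff_of_upperHalfPlane hD hz hg _).2 rfl⟩
  have hc : IsConformalRadius D z (crad D z) := by
    rw [crad, dif_pos hex]
    exact hex.choose_spec
  exact ⟨hc, (isConformalRadius_iff_of_upperHalfPlane hD hz hg _).1 hc⟩

/-! ### The expansion -/

/-- Here `m` stands for `Im (g i)` and `G` for `|g' i|`. The first-order terms cancel exactly,
leaving the two errors and `O(h²)`. Since `h r ≤ 3`, the numerator is at most `(2·27 + 2·6 + 8·3) h
/ r = 90 h / r`. -/
lemma abs_ratio_sub_four_le {h r m G : ℝ} (hr : 100 ≤ r) (hh : 0 < h) (hhr : h * r ^ 2 ≤ 288)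
    (hm : |m - (1 - h)| ≤ 6 * h / r) (hG : |G - (1 + h)| ≤ 27 * h / r) :
    |(2 - 2 * m / G) / h - 4| ≤ 200 / r := by
  have hr0 : 0 < r := by linarith
  have hsmall : h * r ≤ 3 := by nlinarith [mul_pos hh hr0]
  have hsmall' : h ≤ 3 / 100 := by nlinarith
  rw [le_div_iff₀ hr0] at hm hG
  obtain ⟨e₁, he₁⟩ : ∃ e, e = G - (1 + h) := ⟨_, rfl⟩
  obtain ⟨e₂, he₂⟩ : ∃ e, e = m - (1 - h) := ⟨_, rfl⟩
  rw [← he₁] at hG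
  rw [← he₂] at hm
  have he₁h : |e₁| ≤ h := by nlinarith [abs_nonneg e₁]
  have hGlow : 9 / 10 ≤ G := by
    have := neg_abs_le e₁
    linarith
  have hG0 : 0 < G := by linarith
  have hid : (2 - 2 * m / G) / h - 4 = (2 * e₁ - 2 * e₂ - 4 * h * (h + e₁)) / (h * G) := by
    have hGe : G = 1 + h + e₁ := by linarith
    have hme : m = 1 - h + e₂ := by linarith
    rw [hme]
    field_simp
    rw [hGe]
    ring
  rw [hid, abs_div, abs_of_pos (mul_pos hh hG0), div_le_div_iff₀ (mul_pos hh hG0) hr0]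
  have h1 : |2 * e₁ - 2 * e₂ - 4 * h * (h + e₁)| ≤ 2 * |e₁| + 2 * |e₂| + 8 * h * h := by
    rw [abs_le]
    have a1 := neg_abs_le e₁
    have a2 := le_abs_self e₁
    have a3 := neg_abs_le e₂
    have a4 := le_abs_self e₂
    have b1 : h * e₁ ≤ h * h := mul_le_mul_of_nonneg_left (by linarith) hh.le
    have b2 : -(h * h) ≤ h * e₁ := by nlinarith
    constructor <;> nlinarith
  have h2 : (2 * |e₁| + 2 * |e₂| + 8 * h * h) * r ≤ 90 * h := by
    have : h * (h * r) ≤ h * 3 := mul_le_mul_of_nonneg_left hsmall hh.le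
    nlinarith
  calc |2 * e₁ - 2 * e₂ - 4 * h * (h + e₁)| * r ≤ (2 * |e₁| + 2 * |e₂| + 8 * h * h) * r := by gcongr
    _ ≤ 90 * h := h2
    _ ≤ 200 * (h * G) := by nlinarith

lemma abs_crad_estimate {A : Set ℂ} (hA : IsHull A) {r : ℝ} (hr : 100 ≤ r)
    (hAr : ∀ a ∈ A, ‖a‖ * r < 1) {T : ℂ → ℂ} {h : ℝ} (hT : DifferentiableOn ℂ T (ball 0 r))
    (hT0 : T 0 = 0) (hT' : deriv T 0 = h) (hh : 0 < h)
    (hpos : ∀ ζ ∈ ball (0 : ℂ) r, 0 ≤ ζ.im * (T ζ).im)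
    (hg : ConformalOnto (fun z ↦ z - T (-z⁻¹)) (upperHalfPlaneSet \ A) upperHalfPlaneSet) :
    IsConformalRadius (upperHalfPlaneSet \ A) I (crad (upperHalfPlaneSet \ A) I) ∧
      |(2 - crad (upperHalfPlaneSet \ A) I) / h - 4| ≤ 200 / r := by
  have hr0 : 0 < r := by linarith
  have hbound := (norm_sub_le_of_typicallyReal hr0 hT hT0 hpos hT').2
  have hmem : ∀ y : ℝ, 0 < y → 1 ≤ y * r → (y : ℂ) * I ∈ upperHalfPlaneSet \ A := by
    intro y hy hyr
    refine ⟨?_, fun ha ↦ ?_⟩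
    · change 0 < ((y : ℂ) * I).im
      simpa using hy
    · have := hAr _ ha
      rw [norm_mul, norm_I, mul_one, norm_real, Real.norm_of_nonneg hy.le] at this
      linarith
  have hI : I ∈ upperHalfPlaneSet \ A := by simpa using hmem 1 one_pos (by linarith)
  have hnI : -(I : ℂ)⁻¹ = I := by simp
  obtain ⟨hc, hce⟩ := crad_eq_of_upperHalfPlane hA.isOpen_compl hI hg
  refine ⟨hc, ?_⟩
  rw [hce]
  -- At `z = 12 i / r`, outside `A`, positivity of `Im g` gives `Im T (i r / 12) < 12 / r`. The
  -- factor `12` makes the error `h r / 24` half of the main term `h r / 12`, so `h r / 24 < 12 /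
  -- r`.
  have hhr : h * r ^ 2 ≤ 288 := by
    have hη : 0 < r / 12 := by positivity
    have h1 : 0 < (((r / 12)⁻¹ : ℝ) * I - T (-(((r / 12)⁻¹ : ℝ) * I)⁻¹)).im :=
      hg.2.mapsTo (hmem (r / 12)⁻¹ (by positivity) (by field_simp; norm_num))
    have h2 : -((((r / 12)⁻¹ : ℝ) : ℂ) * I)⁻¹ = ((r / 12 : ℝ) : ℂ) * I := by
      rw [mul_inv, inv_I, ofReal_inv, inv_inv]
      ring
    rw [h2, sub_im, im_ofReal_mul, I_im, mul_one] at h1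
    have hn : ‖((r / 12 : ℝ) : ℂ) * I‖ = r / 12 := by
      rw [norm_mul, norm_I, mul_one, norm_real, Real.norm_of_nonneg hη.le]
    have h3 := hbound (((r / 12 : ℝ) : ℂ) * I) (by rw [hn]; linarith)
    rw [hn] at h3
    have h4 := (abs_le.1 ((abs_im_le_norm _).trans h3)).1
    rw [sub_im, im_ofReal_mul, im_ofReal_mul, I_im, mul_one] at h4
    have h5 : 6 * h * (r / 12) ^ 2 / r = h * r / 24 := by field_simp; norm_num
    rw [h5] at h4
    have h6 : h * r / 24 < (r / 12)⁻¹ := by linarith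
    have h7 := mul_lt_mul_of_pos_right h6 hη
    rw [inv_mul_cancel₀ hη.ne'] at h7
    nlinarith
  -- The radius `3/2` covers the disk of radius `1/2` about `I`, on which Cauchy's estimate for `T'
  -- I - h` doubles the bound to `27 h / r`.
  have hnear : ∀ ζ : ℂ, ‖ζ‖ ≤ 3 / 2 → ‖T ζ - h * ζ‖ ≤ 27 / 2 * h / r := by
    intro ζ hζ
    refine (hbound ζ (by linarith)).trans ?_
    have h1 : ‖ζ‖ ^ 2 ≤ 9 / 4 := by nlinarith [norm_nonneg ζ]
    exact div_le_div_of_nonneg_right (by nlinarith) hr0.le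
  have hIr : I ∈ ball (0 : ℂ) r := by
    rw [mem_ball_zero_iff, norm_I]
    linarith
  have hTI : HasDerivAt T (deriv T I) I :=
    (hT.differentiableAt (isOpen_ball.mem_nhds hIr)).hasDerivAt
  have hgI : HasDerivAt (fun z ↦ z - T (-z⁻¹)) (1 + deriv T I) I := by
    have h1 : HasDerivAt (fun z : ℂ ↦ -z⁻¹) (-1) I := by
      simpa using (hasDerivAt_inv I_ne_zero).fun_neg
    have h2 : HasDerivAt T (deriv T I) (-(I : ℂ)⁻¹) := by rwa [hnI]
    have h3 := (hasDerivAt_id I).sub (h2.comp I h1)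
    convert! h3 using 1
    ring
  have hder : ‖deriv T I - h‖ ≤ 27 * h / r := by
    have hsub : closedBall I (1 / 2) ⊆ ball (0 : ℂ) r := by
      intro w hw
      rw [mem_closedBall, dist_eq_norm] at hw
      have := norm_le_norm_add_norm_sub' w I
      rw [norm_I] at this
      rw [mem_ball_zero_iff]
      linarith
    have hd : DifferentiableOn ℂ (fun w ↦ T w - h * w) (ball 0 r) :=
      hT.sub (differentiableOn_id.const_mul _)
    have h1 := norm_deriv_le_of_forall_mem_sphere_norm_le (c := I) (R := 1 / 2)
      (C := 27 / 2 * h / r) (by norm_num) (hd.diffContOnCl_ball hsub) fun w hw ↦ by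
        refine hnear w ?_
        rw [mem_sphere, dist_eq_norm] at hw
        have := norm_le_norm_add_norm_sub' w I
        rw [norm_I] at this
        linarith
    have h2 : deriv (fun w ↦ T w - h * w) I = deriv T I - h := by
      simpa using (hTI.fun_sub ((hasDerivAt_id I).const_mul (h : ℂ))).deriv
    rw [h2] at h1
    refine h1.trans (le_of_eq ?_)
    ring
  refine abs_ratio_sub_four_le hr hh hhr ?_ ?_
  · have h1 := hbound I (by rw [norm_I]; linarith)
    have h2 := (abs_im_le_norm _).trans h1
    rw [norm_I, one_pow, mul_one, sub_im, im_ofReal_mul, I_im, mul_one] at h2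
    rwa [hnI, sub_im, I_im, show 1 - (T I).im - (1 - h) = -((T I).im - h) by ring, abs_neg]
  · rw [hgI.deriv]
    have h1 : ‖(1 + h : ℂ)‖ = 1 + h := by
      rw [← ofReal_one, ← ofReal_add, norm_real, Real.norm_of_nonneg (by positivity)]
    rw [← h1]
    refine (abs_norm_sub_norm_le _ _).trans ?_
    rwa [add_sub_add_left_eq_sub]

theorem proposition3 :
    ∃ C : ℝ, 0 < C ∧ ∃ ε₀ : ℝ, 0 < ε₀ ∧ ε₀ < 1 ∧
      ∀ A : Set ℂ, IsHull A → A.Nonempty →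
        ∀ ε : ℝ, (∀ z ∈ A, ‖z‖ ≤ ε) → ε ≤ ε₀ →
          IsHalfPlaneCapacity A (hcap A) ∧ 0 < hcap A ∧
          IsConformalRadius (UpperHalfPlane.upperHalfPlaneSet \ A) Complex.I
            (crad (UpperHalfPlane.upperHalfPlaneSet \ A) Complex.I) ∧
          |(2 - crad (UpperHalfPlane.upperHalfPlaneSet \ A) Complex.I) / hcap A - 4| ≤ C * ε := by
  -- With `r = 1 / (2ε)` one has `‖a‖ r ≤ 1/2 < 1` on `A`, the bound `200 / r` equals `400 ε`, and
  -- `ε ≤ 1/200` means `r ≥ 100`.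
  refine ⟨400, by norm_num, 1 / 200, by norm_num, by norm_num, fun A hA hne ε hAε hε ↦ ?_⟩
  have hε0 : 0 < ε := by
    obtain ⟨a, ha⟩ := hne
    exact (norm_pos_iff.2 (ne_zero_of_mem_upperHalfPlaneSet (hA.subset ha))).trans_le (hAε a ha)
  set r : ℝ := (2 * ε)⁻¹ with hr
  have hr0 : 0 < r := by positivity
  have hεr : ε * r = 1 / 2 := by rw [hr]; field_simp
  have hr100 : 100 ≤ r := by
    rw [hr, le_inv_comm₀ (by norm_num) (by positivity)]
    linarith
  have hAr : ∀ a ∈ A, ‖a‖ * r < 1 := by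
    intro a ha
    have := mul_le_mul_of_nonneg_right (hAε a ha) hr0.le
    linarith
  obtain ⟨T, h, hT, hT0, hT', hh, hpos, hg⟩ := hA.exists_conformalOnto hne hr0 hAr
  have hTd : HasDerivAt T h 0 := by
    rw [← hT']
    exact (hT.differentiableAt (ball_mem_nhds 0 hr0)).hasDerivAt
  have hcap' : IsHalfPlaneCapacity A h :=
    ⟨_, isHalfPlaneCapacity_of_hasDerivAt hT0 hTd hg⟩
  rw [hcap'.hcap_eq hA]
  obtain ⟨hc, hest⟩ := abs_crad_estimate hA hr100 hAr hT hT0 hT' hh hpos hg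
  refine ⟨hcap', hh, hc, hest.trans (le_of_eq ?_)⟩
  rw [hr]
  field_simp
  norm_num
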